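/- Let ${}^*\mathbb N\subset{}^*\mathbb R\subset{}^*\mathbb C$ be nonstandard extensions (ultrapowers along an arbitrary ultrafilter), let ${}^\circ$ denote the standard part, and let $\eta,\omega,\omega'\in{}^*\mathbb N\setminus\mathbb N$ be such that $\eta-\omega$ is infinite, $\omega<\omega'^{1/2}$ and $\omega'<(\log\eta)^{1/2}$. Put $\overline{\mathcal T}_\eta=\{t\in{}^*\mathbb R:0\le t<\eta\}$ and $\overline{\mathcal R}_\eta=\{x\in{}^*\mathbb R:-\eta\le x<\eta\}$. An internal function on $\overline{\mathcal R}_\eta$ or on $\overline{\mathcal T}_\eta\times\overline{\mathcal R}_\eta$ is called measurable if it is constant on the (products of) cells $[\frac j\eta,\frac{j+1}\eta)$, $j\in{}^*\mathbb Z$; the measurable counterpart of an internal function replaces each of its arguments $x$ by $[\eta x]/\eta$. For measurable $u$ on $\overline{\mathcal R}_\eta$ put $\int u\,d\lambda_\eta=\frac1\eta\,{}^*\!\sum_{j=-\eta^2}^{\eta^2-1}u(\frac j\eta)$. With $\exp_\eta(\pm\pi ixy)$ the measurable counterpart of ${}^*\exp(\pm\pi ixy)$, define for functions $u$ of the space variable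 (and, for each fixed $t$, for functions of $(t,x)$) $$\hat u(y)=\int u(x)\exp_\eta(-\pi ixy)\,d\lambda_\eta(x),\qquad \check u(y)=\int u(x)\exp_\eta(\pi ixy)\,d\lambda_\eta(x).$$ For measurable $f$ on $\overline{\mathcal T}_\eta\times\overline{\mathcal R}_\eta$ let $\partial f/\partial t$ and $\partial f/\partial x$ be the measurable functions given by the forward differences $\eta\,(f(\frac{j+1}\eta,x)-f(\frac j\eta,x))$ on the time cell of $\frac j\eta$, resp. $\eta\,(f(t,\frac{j+1}\eta)-f(t,\frac j\eta))$ on the space cell of $\frac j\eta$, when $j\le\eta^2-2$, and by $0$ on the last cell $j=\eta^2-1$. Let $F_{\omega'}(t,x)=\frac12$ if $-\omega'\eta\le[\eta x]\le\omega'\eta$ and $F_{\omega'}(t,x)=0$ otherwise, let $\psi_\eta(x)=\eta(\exp_\eta(\pi i\frac x\eta)-1)$, and let $h(t,x)=(1+\frac1\eta\psi_\eta(x)^2)^{[\eta t]}$. Let $g:\mathbb R\to\mathbb C$ be continuous with $|g(x)|\le A\exp(B|x|^\rho)$ for all $x\in\mathbb R$, for some real constants $A,B$ and $\rho<2$. Let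 $$H(0,x)=g(x),\qquad H(t,x)=\frac1{\sqrt{4\pi t}}\int_{\mathbb R}\exp\Big(\frac{-(x-y)^2}{4t}\Big)g(y)\,dy\quad(t>0)$$ be the classical solution of the heat equation with boundary condition $g$. Let $g_\eta(x)={}^*g([\eta x]/\eta)$ and $g_{\eta,\omega}=g_\eta\,\chi_{[-\omega,\omega)}$. **Theorem.** There is a measurable $f:\overline{\mathcal T}_\eta\times\overline{\mathcal R}_\eta\to{}^*\mathbb C$, and only one, with $$\frac{\partial f}{\partial t}-\frac{\partial^2f}{\partial x^2}=0\ \text{ on }\ \Big(\overline{\mathcal T}_\eta\setminus\big[\tfrac{\eta^2-1}\eta,\eta\big)\Big)\times\overline{\mathcal R}_\eta,\qquad f(0,x)=g_{\eta,\omega}(x)\ \text{ for }x\in\overline{\mathcal R}_\eta.$$ Its Fourier transform in space is $\hat f(t,x)=h(t,x)\,\hat g_{\eta,\omega}(x)$ for all $x\in\overline{\mathcal R}_\eta$ and all finite $t\in\overline{\mathcal T}_\eta$. For all finite $t\in\overline{\mathcal T}_\eta$ with ${}^\circ t>0$ and all finite $x\in\overline{\mathcal R}_\eta$, the integral defining $H({}^\circ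 t,{}^\circ x)$ converges absolutely, $(F_{\omega'}\hat f)\,\check{}\,(t,x)$ is finite, and $${}^\circ\big((F_{\omega'}\hat f)\,\check{}\,(t,x)\big)=H({}^\circ t,{}^\circ x).$$ -/

import Mathlib

open Filter MeasureTheory

noncomputable section

namespace NSHeat

/-! ## The nonstandard universe

Nonstandard extensions are ultrapowers along an arbitrary ultrafilter `φ` on an arbitrary index
set; for `φ = hyperfilter ℕ` this is the field of hyperreals of Mathlib. Internal
objects (functions in particular) are the elements of the ultrapower of the set of all standard
objects of that kind. -/

/-- The nonstandard extension `*α` of `α`. -/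
abbrev Star {ι : Type*} (φ : Ultrafilter ι) (α : Type*) : Type _ := Germ (φ : Filter ι) α

section

variable {ι : Type*} {φ : Ultrafilter ι}

/-- The value of an internal function of one variable at a nonstandard point. -/
def eval₁ {α β : Type*} (F : Star φ (α → β)) (x : Star φ α) : Star φ β :=
  Germ.map₂ (fun f y => f y) F x

/-- The value of an internal function of two variables at a pair of nonstandard points. -/
def eval₂ {α β γ : Type*} (F : Star φ (α → β → γ)) (t : Star φ α) (x : Star φ β) : Star φ γ :=
  eval₁ (eval₁ F t) x

/-- The inclusion `*ℕ ⊆ *ℝ`. -/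
def toHyperreal (ν : Star φ ℕ) : Star φ ℝ := Germ.map (fun n : ℕ => (n : ℝ)) ν

/-- `ν ∈ *ℕ ∖ ℕ`. -/
def IsInfiniteNat (ν : Star φ ℕ) : Prop := ∀ n : ℕ, ν ≠ (↑n : Star φ ℕ)

/-- `z` is finite with standard part `w`: the distance of `z` and `w` is infinitesimal. -/
def HasStandardPart {E : Type*} [NormedAddCommGroup E] (z : Star φ E) (w : E) : Prop :=
  ∀ ε : ℝ, 0 < ε → Germ.map (fun v : E => ‖v - w‖) z < (↑ε : Star φ ℝ)

end

/-! ## Discrete analysis on `[-n, n)` with mesh `1 / n`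

Below `n` is a positive natural number; the value at `n = 0` is irrelevant. -/

/-- The left end point of the cell `[j / n, (j + 1) / n)` that contains `x`. -/
def cell (n : ℕ) (x : ℝ) : ℝ := (⌊(n : ℝ) * x⌋ : ℝ) / n

/-- `f`, as a function on `[0, n) × [-n, n)`, is measurable for the finite algebra generated by
the cells, that is, it is constant on products of cells. -/
def CellMeasurable (n : ℕ) (f : ℝ → ℝ → ℂ) : Prop :=
  ∀ t x : ℝ, 0 ≤ t → t < n → -(n : ℝ) ≤ x → x < n → f t x = f (cell n t) (cell n x)

/-- The integral over `[-n, n)` of a cell-measurable function: each cell has measure `1 / n`. -/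
def gridIntegral (n : ℕ) (f : ℝ → ℂ) : ℂ :=
  (1 / (n : ℂ)) * ∑ j ∈ Finset.Ico (-(n : ℤ) ^ 2) ((n : ℤ) ^ 2), f ((j : ℝ) / n)

/-- The discrete partial derivative in time: a forward difference, and `0` on the last cell. -/
def discreteDt (n : ℕ) (f : ℝ → ℝ → ℂ) (t x : ℝ) : ℂ :=
  if ⌊(n : ℝ) * t⌋ ≤ (n : ℤ) ^ 2 - 2 then
    (n : ℂ) * (f (((⌊(n : ℝ) * t⌋ : ℝ) + 1) / n) x - f ((⌊(n : ℝ) * t⌋ : ℝ) / n) x)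
  else 0

/-- The discrete partial derivative in space: a forward difference, and `0` on the last cell. -/
def discreteDx (n : ℕ) (f : ℝ → ℝ → ℂ) (t x : ℝ) : ℂ :=
  if ⌊(n : ℝ) * x⌋ ≤ (n : ℤ) ^ 2 - 2 then
    (n : ℂ) * (f t (((⌊(n : ℝ) * x⌋ : ℝ) + 1) / n) - f t ((⌊(n : ℝ) * x⌋ : ℝ) / n))
  else 0

/-- The cell-measurable counterpart of `exp (π i x y)`. -/
def gridExp (n : ℕ) (x y : ℝ) : ℂ :=
  Complex.exp (Real.pi * Complex.I * (cell n x : ℂ) * (cell n y : ℂ))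

/-- The cell-measurable counterpart of `exp (-π i x y)`. -/
def gridExpNeg (n : ℕ) (x y : ℝ) : ℂ :=
  Complex.exp (-(Real.pi * Complex.I * (cell n x : ℂ) * (cell n y : ℂ)))

/-- The discrete Fourier transform on `[-n, n)`. -/
def gridFourier (n : ℕ) (f : ℝ → ℂ) (y : ℝ) : ℂ :=
  gridIntegral n (fun x => f x * gridExpNeg n x y)

/-- The discrete inverse Fourier transform on `[-n, n)`. -/
def gridFourierInv (n : ℕ) (f : ℝ → ℂ) (y : ℝ) : ℂ :=
  gridIntegral n (fun x => f x * gridExp n x y)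

/-- `ψ_n(x) = n (exp_n (π i x / n) - 1)`. -/
def gridPsi (n : ℕ) (x : ℝ) : ℂ := (n : ℂ) * (gridExp n x (1 / (n : ℝ)) - 1)

/-- `h(t, x) = (1 + ψ_n(x)² / n) ^ [n t]`. -/
def gridSymbol (n : ℕ) (t x : ℝ) : ℂ := (1 + gridPsi n x ^ 2 / (n : ℂ)) ^ ⌊(n : ℝ) * t⌋₊

/-- The truncation: `1 / 2` on the cells `[j / n, (j + 1) / n)` with `-m n ≤ j ≤ m n`,
and `0` elsewhere. -/
def gridTrunc (n m : ℕ) (_t x : ℝ) : ℂ :=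
  if -((m : ℤ) * n) ≤ ⌊(n : ℝ) * x⌋ ∧ ⌊(n : ℝ) * x⌋ ≤ (m : ℤ) * n then 1 / 2 else 0

/-- The cell-measurable counterpart of `g`, truncated to `[-w, w)`. -/
def gridData (g : ℝ → ℂ) (n w : ℕ) (x : ℝ) : ℂ :=
  if -(w : ℝ) ≤ x ∧ x < w then g (cell n x) else 0

/-! ## The transferred objects -/

section

variable {ι : Type*} {φ : Ultrafilter ι}

/-- `-η ≤ x < η`. -/
def InSpace (η : Star φ ℕ) (x : Star φ ℝ) : Prop := -toHyperreal η ≤ x ∧ x < toHyperreal η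

/-- `0 ≤ t < η`. -/
def InTime (η : Star φ ℕ) (t : Star φ ℝ) : Prop := 0 ≤ t ∧ t < toHyperreal η

/-- The discrete partial derivative `∂/∂t` of an internal function. -/
def starDt (η : Star φ ℕ) (f : Star φ (ℝ → ℝ → ℂ)) : Star φ (ℝ → ℝ → ℂ) :=
  Germ.map₂ discreteDt η f

/-- The discrete partial derivative `∂/∂x` of an internal function. -/
def starDx (η : Star φ ℕ) (f : Star φ (ℝ → ℝ → ℂ)) : Star φ (ℝ → ℝ → ℂ) :=
  Germ.map₂ discreteDx η f

/-- The nonstandard Fourier transform of an internal function of the space variable. -/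
def starFourier₁ (η : Star φ ℕ) (f : Star φ (ℝ → ℂ)) : Star φ (ℝ → ℂ) :=
  Germ.map₂ gridFourier η f

/-- The nonstandard Fourier transform in space. -/
def starFourier (η : Star φ ℕ) (f : Star φ (ℝ → ℝ → ℂ)) : Star φ (ℝ → ℝ → ℂ) :=
  Germ.map₂ (fun n f t => gridFourier n (f t)) η f

/-- The nonstandard inverse Fourier transform in space. -/
def starFourierInv (η : Star φ ℕ) (f : Star φ (ℝ → ℝ → ℂ)) : Star φ (ℝ → ℝ → ℂ) :=
  Germ.map₂ (fun n f t => gridFourierInv n (f t)) η f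

/-- The internal function `h(t, x) = (1 + ψ_η(x)² / η) ^ [η t]`. -/
def starSymbol (η : Star φ ℕ) : Star φ (ℝ → ℝ → ℂ) := Germ.map gridSymbol η

/-- The internal truncation function `F_ω'`. -/
def starTrunc (η ω' : Star φ ℕ) : Star φ (ℝ → ℝ → ℂ) := Germ.map₂ gridTrunc η ω'

/-- The internal boundary data `g_{η,ω}`: the measurable counterpart `x ↦ *g([η x] / η)` of `g`,
multiplied by the characteristic function of `[-ω, ω)`. -/
def starData (g : ℝ → ℂ) (η ω : Star φ ℕ) : Star φ (ℝ → ℂ) := Germ.map₂ (gridData g) η ω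

/-- An internal function on `[0, η) × [-η, η)` is measurable for the hyperfinite algebra of
internal unions of products of cells: it is constant on products of cells. -/
def IsStarMeasurable (η : Star φ ℕ) (f : Star φ (ℝ → ℝ → ℂ)) : Prop :=
  Germ.LiftRel CellMeasurable η f

/-- `f` is a measurable solution of the nonstandard heat equation `∂f/∂t - ∂²f/∂x² = 0` on
`([0, η) ∖ [(η² - 1) / η, η)) × [-η, η)`, with `f(0, x) = b(x)`. -/
structure IsHeatSolution (η : Star φ ℕ) (b : Star φ (ℝ → ℂ)) (f : Star φ (ℝ → ℝ → ℂ)) :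
    Prop where
  measurable : IsStarMeasurable η f
  heat : ∀ t x : Star φ ℝ, 0 ≤ t → t < (toHyperreal η ^ 2 - 1) / toHyperreal η → InSpace η x →
    eval₂ (starDt η f) t x - eval₂ (starDx η (starDx η f)) t x = 0
  initial : ∀ x : Star φ ℝ, InSpace η x → eval₂ f 0 x = eval₁ b x

end

/-! ## The classical solution -/

/-- The integrand of the classical solution, without its factor `1 / √(4 π t)`. -/
def heatIntegrand (g : ℝ → ℂ) (t x y : ℝ) : ℂ :=
  (Real.exp (-(x - y) ^ 2 / (4 * t)) : ℂ) * g y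

/-- The classical solution of the heat equation with boundary condition `g`, for `t ≥ 0`. -/
def classicalSolution (g : ℝ → ℂ) (t x : ℝ) : ℂ :=
  if t = 0 then g x
  else ((1 / Real.sqrt (4 * Real.pi * t) : ℝ) : ℂ) * ∫ y : ℝ, heatIntegrand g t x y

end NSHeat

end

noncomputable section

namespace NSHeat

/-! ## Cells and sums over cells -/

/-! Choose representatives. The infinite numbers `η`, `ω`, `ω'` become families `n i`, `w i`, `m i`
tending to infinity along `φ`, an internal solution becomes a family of discrete solutions
(`isHeatSolution_coe`), and a standard part becomes a limit along `φ`. What is left are estimates on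
a single grid.

The discrete equation is an explicit time-stepping scheme, so its solution exists and is unique
(`IsGridSolution.apply`). One time step moves the left end of the support by two cells and the right
end not at all. As `η - ω` is infinite, the support stays inside the grid for all finite times, so
shifting the summation index produces no boundary terms, and every time step multiplies the Fourier
transform by `1 + ψ² / n` (`tsum_gridSol`).

This scheme is unstable: at `y = -n` the factor is `1 + 4 n`. The truncation keeps only the
frequencies `|y| ≤ m`, where the symbol is close to `exp (-π² t y²)`. Inverting the truncated
transform convolves the data with `gridKernel`, which differs from the heat kernel by a polynomial
in `m` divided by `n` plus a tail of size `exp (-a m²)` (`norm_gridKernel_sub_heatKernel_le`). The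
data are at most `C exp (w²)`, so `w² < m` and `m² < log n` leave a total error of order `m⁶ exp (m
- a m²)`, which tends to `0` (`kernel_error_le`). What remains is a Riemann sum of the classical
integral. It converges by dominated convergence, since growth of order `ρ < 2` is beaten by every
Gaussian (`tendsto_sum_heatKernel`). -/

theorem floor_mul_div {n : ℕ} (hn : 0 < n) (j : ℤ) : ⌊(n : ℝ) * ((j : ℝ) / n)⌋ = j := by
  have : (n : ℝ) ≠ 0 := by positivity
  rw [mul_div_cancel₀ _ this, Int.floor_intCast]

theorem cell_intCast_div {n : ℕ} (hn : 0 < n) (j : ℤ) : cell n ((j : ℝ) / n) = (j : ℝ) / n := by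
  unfold cell; rw [floor_mul_div hn]

theorem floor_mul_cell {n : ℕ} (hn : 0 < n) (x : ℝ) : ⌊(n : ℝ) * cell n x⌋ = ⌊(n : ℝ) * x⌋ :=
  floor_mul_div hn _

theorem cell_le {n : ℕ} (hn : 0 < n) (x : ℝ) : cell n x ≤ x := by
  have : (0 : ℝ) < n := by positivity
  unfold cell
  rw [div_le_iff₀ this, mul_comm x]
  exact Int.floor_le _

theorem sub_cell_le {n : ℕ} (hn : 0 < n) (x : ℝ) : x - cell n x ≤ 1 / n := by
  have : (0 : ℝ) < n := by positivity
  unfold cell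
  rw [sub_le_iff_le_add, ← add_div, le_div_iff₀ this]
  linarith [Int.lt_floor_add_one ((n : ℝ) * x)]

/-- The step function that takes the value `F (j / n)` on the cells with `a ≤ j < b`. -/
def stepFun (n : ℕ) (a b : ℤ) (F : ℝ → ℂ) (y : ℝ) : ℂ :=
  if a ≤ ⌊(n : ℝ) * y⌋ ∧ ⌊(n : ℝ) * y⌋ < b then F (cell n y) else 0

theorem stepFun_eq_sum {n : ℕ} (hn : 0 < n) (a b : ℤ) (F : ℝ → ℂ) (y : ℝ) :
    stepFun n a b F y = ∑ j ∈ Finset.Ico a b,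
      (Set.Ico ((j : ℝ) / n) (((j : ℝ) + 1) / n)).indicator (fun _ => F ((j : ℝ) / n)) y := by
  have hn' : (0 : ℝ) < n := by positivity
  have key : ∀ j : ℤ, y ∈ Set.Ico ((j : ℝ) / n) (((j : ℝ) + 1) / n) ↔ j = ⌊(n : ℝ) * y⌋ := by
    intro j
    rw [Set.mem_Ico, div_le_iff₀ hn', lt_div_iff₀ hn', mul_comm y, eq_comm, Int.floor_eq_iff]
  simp only [Set.indicator_apply, key]
  rw [Finset.sum_ite_eq' (Finset.Ico a b) ⌊(n : ℝ) * y⌋ (fun j => F ((j : ℝ) / n))]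
  simp only [Finset.mem_Ico, stepFun, cell]

theorem integrable_stepFun {n : ℕ} (hn : 0 < n) (a b : ℤ) (F : ℝ → ℂ) :
    Integrable (stepFun n a b F) := by
  rw [funext (stepFun_eq_sum hn a b F)]
  refine integrable_finsetSum _ fun j _ => ?_
  rw [integrable_indicator_iff measurableSet_Ico]
  exact integrableOn_const (by simp)

/-- Grid sums become Lebesgue integrals, so that they can be compared with Gaussian integrals and
passed to the limit by dominated convergence. -/
theorem integral_stepFun {n : ℕ} (hn : 0 < n) (a b : ℤ) (F : ℝ → ℂ) :
    ∫ y, stepFun n a b F y = (1 / (n : ℂ)) * ∑ j ∈ Finset.Ico a b, F ((j : ℝ) / n) := by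
  rw [funext (stepFun_eq_sum hn a b F), integral_finsetSum, Finset.mul_sum]
  · refine Finset.sum_congr rfl fun j _ => ?_
    rw [integral_indicator measurableSet_Ico, setIntegral_const, measureReal_def, Real.volume_Ico,
      ← sub_div, add_sub_cancel_left, ENNReal.toReal_ofReal (by positivity), Complex.real_smul]
    push_cast
    rfl
  · intro j _
    rw [integrable_indicator_iff measurableSet_Ico]
    exact integrableOn_const (by simp)

/-! ## Elementary estimates -/

/-- The base `a` may have modulus slightly above `1`; the factor `(1 + ε) ^ k` pays for that in the
telescoping induction. -/
theorem norm_pow_sub_pow_le {a b : ℂ} {ε : ℝ} (hb : ‖b‖ ≤ 1) (hab : ‖a - b‖ ≤ ε) (k : ℕ) :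
    ‖a ^ k - b ^ k‖ ≤ k * ε * (1 + ε) ^ k := by
  have hε : 0 ≤ ε := (norm_nonneg _).trans hab
  have ha : ‖a‖ ≤ 1 + ε := by
    calc ‖a‖ = ‖b + (a - b)‖ := by ring_nf
      _ ≤ _ := (norm_add_le _ _).trans (add_le_add hb hab)
  induction k with
  | zero => simp
  | succ k ih =>
    have h1 : a ^ (k + 1) - b ^ (k + 1) = a * (a ^ k - b ^ k) + (a - b) * b ^ k := by ring
    have h2 : ‖b ^ k‖ ≤ 1 := by rw [norm_pow]; exact pow_le_one₀ (norm_nonneg _) hb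
    have h3 : (1 : ℝ) ≤ (1 + ε) ^ (k + 1) := one_le_pow₀ (by linarith)
    calc ‖a ^ (k + 1) - b ^ (k + 1)‖ ≤ ‖a‖ * ‖a ^ k - b ^ k‖ + ‖a - b‖ * ‖b ^ k‖ := by
          rw [h1, ← norm_mul, ← norm_mul]; exact norm_add_le _ _
      _ ≤ (1 + ε) * (k * ε * (1 + ε) ^ k) + ε * 1 := by gcongr
      _ ≤ (1 + ε) * (k * ε * (1 + ε) ^ k) + ε * (1 + ε) ^ (k + 1) := by gcongr
      _ = _ := by push_cast; ring

/-- Mean value inequality on the convex left half-plane, where the derivative of `exp` has modulus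
at most `1`. -/
theorem norm_cexp_sub_cexp_le {u v : ℂ} (hu : u.re ≤ 0) (hv : v.re ≤ 0) :
    ‖Complex.exp u - Complex.exp v‖ ≤ ‖u - v‖ := by
  have := (convex_halfSpace_re_le 0).norm_image_sub_le_of_norm_hasDerivWithin_le (𝕜 := ℂ)
    (f := Complex.exp) (f' := Complex.exp) (C := 1) (x := v) (y := u)
    (fun x _ => (Complex.hasDerivAt_exp x).hasDerivWithinAt)
    (fun x hx => by rw [Complex.norm_exp]; exact Real.exp_le_one_iff.2 hx) hv hu
  simpa using this

/-- One step of the discrete heat semigroup against one step of the continuous one, on the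
Fourier side. -/
theorem norm_symbol_sub_le {N θ : ℝ} (hN : 0 ≤ N) (hθ : |θ| ≤ 1) (hNθ : N * θ ^ 2 ≤ 1) :
    ‖(1 + N * (Complex.exp (θ * Complex.I) - 1) ^ 2) - Complex.exp ((-(N * θ ^ 2) : ℝ) : ℂ)‖
      ≤ 3 * N * |θ| ^ 3 + N ^ 2 * θ ^ 4 := by
  set r : ℂ := Complex.exp (θ * Complex.I) - 1 - θ * Complex.I with hr
  have hn : ‖(θ : ℂ) * Complex.I‖ = |θ| := by simp
  have hr1 : ‖r‖ ≤ |θ| ^ 2 := by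
    have := Complex.norm_exp_sub_one_sub_id_le (x := θ * Complex.I) (by rw [hn]; exact hθ)
    rwa [hn] at this
  set s : ℝ := N * θ ^ 2 with hs
  have hs0 : 0 ≤ s := by positivity
  have hs1 : ‖Complex.exp (-s : ℝ) - 1 - (-s : ℝ)‖ ≤ s ^ 2 := by
    have := Complex.norm_exp_sub_one_sub_id_le (x := ((-s : ℝ) : ℂ))
      (by rw [Complex.norm_real, Real.norm_eq_abs, abs_neg, abs_of_nonneg hs0]; exact hNθ)
    rwa [Complex.norm_real, Real.norm_eq_abs, sq_abs, neg_sq] at this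
  -- The square of `iθ + r` is `-θ² + 2iθr + r²`; its leading term, multiplied by `N`, cancels the
  -- linear term of `exp (-s)`.
  have e1 : (1 + N * (Complex.exp (θ * Complex.I) - 1) ^ 2) - Complex.exp (-s : ℝ)
      = N * (2 * (θ * Complex.I) * r + r ^ 2)
        - (Complex.exp (-s : ℝ) - 1 - (-s : ℝ)) := by
    have : Complex.exp (θ * Complex.I) - 1 = θ * Complex.I + r := by rw [hr]; ring
    rw [this, hs]
    push_cast
    linear_combination (N * θ ^ 2 : ℂ) * Complex.I_sq
  have e2 : ‖(N : ℂ) * (2 * (θ * Complex.I) * r + r ^ 2)‖ ≤ N * (2 * |θ| * |θ| ^ 2 + (|θ| ^ 2) ^ 2) := by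
    rw [norm_mul, Complex.norm_real, Real.norm_eq_abs, abs_of_nonneg hN]
    gcongr
    refine (norm_add_le _ _).trans ?_
    rw [norm_mul, norm_mul, norm_pow, hn]
    simp only [Complex.norm_ofNat]
    gcongr
  rw [e1]
  refine (norm_sub_le _ _).trans ((add_le_add e2 hs1).trans ?_)
  have h4 : |θ| ^ 4 ≤ |θ| ^ 3 := pow_le_pow_of_le_one (abs_nonneg _) hθ (by norm_num)
  have : N * |θ| ^ 4 ≤ N * |θ| ^ 3 := by gcongr
  calc N * (2 * |θ| * |θ| ^ 2 + (|θ| ^ 2) ^ 2) + s ^ 2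
      = 2 * (N * |θ| ^ 3) + N * |θ| ^ 4 + N ^ 2 * θ ^ 4 := by rw [hs]; ring
    _ ≤ _ := by linarith

/-! ### The discrete symbol, the Gaussian and the truncated kernel -/

theorem gridPsi_apply {n : ℕ} (hn : 0 < n) (x : ℝ) :
    gridPsi n x =
      n * (Complex.exp ((Real.pi * cell n x / n : ℝ) * Complex.I) - 1) := by
  have h : cell n (1 / (n : ℝ)) = 1 / n := by simpa using cell_intCast_div hn 1
  rw [gridPsi, gridExp, h]
  congr 3
  push_cast
  ring

/-- The exponent `-π² y² τ + π i y z` of the Fourier integral that represents the heat kernel. -/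
def heatPhase (τ z y : ℝ) : ℂ :=
  ((-(Real.pi ^ 2 * τ * y ^ 2) : ℝ) : ℂ) + ((Real.pi * y * z : ℝ) : ℂ) * Complex.I

theorem heatPhase_re (τ z y : ℝ) : (heatPhase τ z y).re = -(Real.pi ^ 2 * τ * y ^ 2) := by
  rw [heatPhase, Complex.add_re, Complex.re_ofReal_mul, Complex.ofReal_re, Complex.I_re, mul_zero,
    add_zero]

theorem norm_exp_heatPhase (τ z y : ℝ) :
    ‖Complex.exp (heatPhase τ z y)‖ = Real.exp (-(Real.pi ^ 2 * τ * y ^ 2)) := by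
  rw [Complex.norm_exp, heatPhase_re]

/-- The heat kernel. -/
def heatKernel (τ z : ℝ) : ℝ := 1 / Real.sqrt (4 * Real.pi * τ) * Real.exp (-z ^ 2 / (4 * τ))

theorem integrable_exp_heatPhase {τ : ℝ} (hτ : 0 < τ) (z : ℝ) :
    Integrable fun y => Complex.exp (heatPhase τ z y) := by
  have h : (((-(Real.pi ^ 2 * τ) : ℝ) : ℂ)).re < 0 := by
    rw [Complex.ofReal_re]; have := Real.pi_pos; simp only [neg_lt_zero]; positivity
  refine (integrable_cexp_quadratic' h ((Real.pi * z : ℝ) * Complex.I) 0).congr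
    (Eventually.of_forall fun y => ?_)
  simp only [heatPhase]
  congr 1
  push_cast
  ring

/-- Fourier inversion of a Gaussian. With the character `exp (π i x y)` the inversion formula
carries a factor `1 / 2`, which is the height of the truncation `F_ω'`. -/
theorem integral_exp_heatPhase {τ : ℝ} (hτ : 0 < τ) (z : ℝ) :
    (1 / 2 : ℂ) * ∫ y, Complex.exp (heatPhase τ z y) = heatKernel τ z := by
  have hpi := Real.pi_pos
  have h : (((-(Real.pi ^ 2 * τ) : ℝ) : ℂ)).re < 0 := by
    rw [Complex.ofReal_re]; simp only [neg_lt_zero]; positivity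
  have := integral_cexp_quadratic h ((Real.pi * z : ℝ) * Complex.I) 0
  have e : ∀ y : ℝ, Complex.exp (heatPhase τ z y) = Complex.exp (((-(Real.pi ^ 2 * τ) : ℝ) : ℂ) *
      (y : ℂ) ^ 2 + ((Real.pi * z : ℝ) * Complex.I) * y + 0) := by
    intro y
    simp only [heatPhase]
    congr 1
    push_cast
    ring
  rw [funext e, this]
  have h1 : (0 : ℂ) - ((Real.pi * z : ℝ) * Complex.I) ^ 2 / (4 * ((-(Real.pi ^ 2 * τ) : ℝ) : ℂ))
      = ((-z ^ 2 / (4 * τ) : ℝ) : ℂ) := by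
    have : (τ : ℂ) ≠ 0 := by exact_mod_cast hτ.ne'
    have : (Real.pi : ℂ) ≠ 0 := by exact_mod_cast hpi.ne'
    push_cast
    rw [mul_pow, Complex.I_sq]
    field_simp
    ring
  have h2 : ((Real.pi : ℂ) / -((-(Real.pi ^ 2 * τ) : ℝ) : ℂ)) ^ (1 / 2 : ℂ)
      = ((2 * (1 / Real.sqrt (4 * Real.pi * τ)) : ℝ) : ℂ) := by
    have e1 : (Real.pi : ℂ) / -((-(Real.pi ^ 2 * τ) : ℝ) : ℂ) = ((1 / (Real.pi * τ) : ℝ) : ℂ) := by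
      push_cast
      have : (Real.pi : ℂ) ≠ 0 := by exact_mod_cast hpi.ne'
      field_simp
    have e2 : (1 / 2 : ℂ) = ((1 / 2 : ℝ) : ℂ) := by push_cast; rfl
    rw [e1, e2, ← Complex.ofReal_cpow (by positivity), ← Real.sqrt_eq_rpow]
    congr 1
    rw [show 4 * Real.pi * τ = 2 ^ 2 * (Real.pi * τ) by ring,
      Real.sqrt_mul (by positivity), Real.sqrt_sq (by norm_num), Real.sqrt_div zero_le_one,
      Real.sqrt_one]
    field_simp
  rw [h1, h2, heatKernel]
  push_cast
  ring

/-- The left end point of the time cell of `t ≥ 0`. -/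
def timeCell (n : ℕ) (t : ℝ) : ℝ := (⌊(n : ℝ) * t⌋₊ : ℝ) / n

/-- The error of one step is at most `448 M⁴ / n²`, and at most `n T` steps are made. The lower
bound on `n` makes the accumulated error at most `1`, so the amplification `(1 + ε) ^ k` is at most
`e < 3`, whence `1344 = 3 * 448`. -/
theorem norm_gridSymbol_sub_le {n : ℕ} {M T t y : ℝ} (hM : 1 ≤ M) (hT : 1 ≤ T)
    (hn : 448 * T * M ^ 4 ≤ n) (ht : timeCell n t ≤ T) (hy : |cell n y| ≤ M) :
    ‖gridSymbol n t y - Complex.exp (heatPhase (timeCell n t) 0 (cell n y))‖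
      ≤ 1344 * T * M ^ 4 / n := by
  have hM4 : 1 ≤ M ^ 4 := one_le_pow₀ hM
  have hM24 : M ^ 2 ≤ M ^ 4 := pow_le_pow_right₀ hM (by norm_num)
  have hM34 : M ^ 3 ≤ M ^ 4 := pow_le_pow_right₀ hM (by norm_num)
  have hM14 : M ≤ M ^ 4 := by simpa using pow_le_pow_right₀ hM (show 1 ≤ 4 by norm_num)
  have hTM : M ^ 4 ≤ T * M ^ 4 := le_mul_of_one_le_left (by positivity) hT
  have hn0 : (0 : ℝ) < n := by linarith
  have hn1 : 0 < n := by exact_mod_cast hn0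
  have hpi : |Real.pi| ≤ 4 := by rw [abs_of_pos Real.pi_pos]; exact Real.pi_le_four
  set c := cell n y with hc
  set k := ⌊(n : ℝ) * t⌋₊ with hk
  set θ : ℝ := Real.pi * c / n with hθ
  have hθ0 : |θ| ≤ 4 * M / n := by
    rw [hθ, abs_div, abs_mul, abs_of_pos hn0]
    gcongr
  have hθ1 : |θ| ≤ 1 := hθ0.trans (by rw [div_le_one hn0]; linarith)
  have hθ2 : n * θ ^ 2 ≤ 1 := by
    rw [← sq_abs]
    calc (n : ℝ) * |θ| ^ 2 ≤ n * (4 * M / n) ^ 2 := by gcongr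
      _ = 16 * M ^ 2 / n := by field_simp; ring
      _ ≤ 1 := by rw [div_le_one hn0]; linarith
  -- With `|θ| ≤ 4 M / n`, the one-step bound gives `3 * 4³ + 4⁴ = 448`.
  set ε : ℝ := 448 * M ^ 4 / n ^ 2 with hε
  have hε0 : 0 ≤ ε := by positivity
  have hstep : ‖(1 + ((n : ℝ) : ℂ) * (Complex.exp (θ * Complex.I) - 1) ^ 2)
      - Complex.exp ((-(n * θ ^ 2) : ℝ) : ℂ)‖ ≤ ε := by
    refine (norm_symbol_sub_le hn0.le hθ1 hθ2).trans ?_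
    have : θ ^ 4 = |θ| ^ 4 := by rw [← abs_pow, abs_of_nonneg (by positivity)]
    rw [this]
    calc 3 * (n : ℝ) * |θ| ^ 3 + n ^ 2 * |θ| ^ 4
        ≤ 3 * (n : ℝ) * (4 * M / n) ^ 3 + n ^ 2 * (4 * M / n) ^ 4 := by gcongr
      _ = (192 * M ^ 3 + 256 * M ^ 4) / n ^ 2 := by field_simp; ring
      _ ≤ ε := by rw [hε]; gcongr; linarith
  have hb : ‖Complex.exp ((-(n * θ ^ 2) : ℝ) : ℂ)‖ ≤ 1 := by
    rw [Complex.norm_exp, Complex.ofReal_re, Real.exp_le_one_iff, neg_nonpos]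
    positivity
  have e1 : gridSymbol n t y =
      (1 + ((n : ℝ) : ℂ) * (Complex.exp (θ * Complex.I) - 1) ^ 2) ^ k := by
    have : (n : ℂ) ≠ 0 := by exact_mod_cast hn0.ne'
    rw [gridSymbol, gridPsi_apply hn1, ← hc, ← hθ, ← hk, Complex.ofReal_natCast, mul_pow,
      mul_div_right_comm, sq (n : ℂ), mul_div_cancel_right₀ _ this]
  have e2 : Complex.exp (heatPhase (timeCell n t) 0 c) =
      Complex.exp ((-(n * θ ^ 2) : ℝ) : ℂ) ^ k := by
    rw [← Complex.exp_nat_mul, heatPhase, timeCell, ← hk, hθ]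
    congr 1
    have : (n : ℂ) ≠ 0 := by exact_mod_cast hn0.ne'
    push_cast
    field_simp
    ring
  have hkε : k * ε ≤ 448 * T * M ^ 4 / n := by
    have hkn : (k : ℝ) / n ≤ T := ht
    calc k * ε = (k / n) * (448 * M ^ 4 / n) := by rw [hε]; field_simp
      _ ≤ T * (448 * M ^ 4 / n) := by gcongr
      _ = _ := by ring
  have hexp : (1 + ε) ^ k ≤ 3 := by
    calc (1 + ε) ^ k ≤ Real.exp ε ^ k := by
          gcongr; rw [add_comm]; exact Real.add_one_le_exp ε
      _ = Real.exp (k * ε) := by rw [← Real.exp_nat_mul]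
      _ ≤ Real.exp 1 := Real.exp_le_exp.2 (hkε.trans (by rwa [div_le_one hn0]))
      _ ≤ 3 := by linarith [Real.exp_one_lt_d9]
  rw [e1, e2]
  calc _ ≤ k * ε * (1 + ε) ^ k := norm_pow_sub_pow_le hb hstep k
    _ ≤ (448 * T * M ^ 4 / n) * 3 := by gcongr
    _ = _ := by ring

theorem norm_exp_heatPhase_sub_le {τ z c y T M Z d : ℝ} (hτ : 0 ≤ τ) (hτT : τ ≤ T) (hM : 1 ≤ M)
    (hz : |z| ≤ Z) (hc : |c| ≤ M) (hd : d ≤ 1) (hcy : |c - y| ≤ d) :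
    ‖Complex.exp (heatPhase τ z c) - Complex.exp (heatPhase τ z y)‖
      ≤ (48 * T * M + 4 * Z) * d := by
  have hpi := Real.pi_pos
  have hd0 : 0 ≤ d := (abs_nonneg _).trans hcy
  have hre : ∀ u, (heatPhase τ z u).re ≤ 0 := fun u => by
    rw [heatPhase_re, neg_nonpos]; positivity
  refine (norm_cexp_sub_cexp_le (hre c) (hre y)).trans ?_
  have e : heatPhase τ z c - heatPhase τ z y =
      ((-(Real.pi ^ 2 * τ * ((c + y) * (c - y))) : ℝ) : ℂ)
        + ((Real.pi * (c - y) * z : ℝ) : ℂ) * Complex.I := by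
    simp only [heatPhase]; push_cast; ring
  have hy : |c + y| ≤ 3 * M := by
    have : c + y = c + c - (c - y) := by ring
    rw [this]
    refine (abs_sub _ _).trans ((add_le_add (abs_add_le _ _) hcy).trans ?_)
    linarith
  rw [e]
  refine (norm_add_le _ _).trans ?_
  rw [norm_mul, Complex.norm_I, mul_one, Complex.norm_real, Complex.norm_real, norm_neg,
    Real.norm_eq_abs, Real.norm_eq_abs, abs_mul, abs_mul, abs_mul, abs_mul, abs_mul, abs_pow,
    abs_of_pos hpi, abs_of_nonneg hτ]
  have h4 := Real.pi_le_four
  have hT : 0 ≤ T := hτ.trans hτT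
  calc Real.pi ^ 2 * τ * (|c + y| * |c - y|) + Real.pi * |c - y| * |z|
      ≤ 4 ^ 2 * T * (3 * M * d) + 4 * d * Z := by gcongr
    _ = _ := by ring

/-- The kernel of the truncated inverse Fourier transform of the discrete heat symbol. -/
def gridKernel (n m : ℕ) (t z : ℝ) : ℂ :=
  (1 / 2) * ((1 / (n : ℂ)) * ∑ j ∈ Finset.Ico (-((m : ℤ) * n)) ((m : ℤ) * n + 1),
    gridSymbol n t ((j : ℝ) / n) * Complex.exp ((Real.pi * ((j : ℝ) / n) * z : ℝ) * Complex.I))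

/-- Inside the window the error of the symbol (`1344`) and the displacement from `y` to its cell
(`48`) add up to `1392`. Outside it the step function vanishes and half of the Gaussian exponent is
spent on the small factor `exp (-a m²)`, the other half on integrability. The indicator reaches to
`m + 1` because the cell that starts at `m` belongs to the window. -/
theorem norm_stepFun_sub_le {n m : ℕ} {T Z a t z : ℝ} (hm : 1 ≤ m) (hT : 1 ≤ T)
    (hn : 448 * T * (m : ℝ) ^ 4 ≤ n) (ht : timeCell n t ≤ T) (ht0 : 0 ≤ timeCell n t)
    (hz : |z| ≤ Z) (ha : 2 * a ≤ Real.pi ^ 2 * timeCell n t) (ha0 : 0 < a) (y : ℝ) :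
    ‖stepFun n (-((m : ℤ) * n)) ((m : ℤ) * n + 1)
        (fun y => gridSymbol n t y * Complex.exp ((Real.pi * y * z : ℝ) * Complex.I)) y
        - Complex.exp (heatPhase (timeCell n t) z y)‖
      ≤ (Set.Icc (-((m : ℝ) + 1)) (m + 1)).indicator
          (fun _ => (1392 * T * (m : ℝ) ^ 4 + 4 * Z) / n) y
        + Real.exp (-a * (m : ℝ) ^ 2) * Real.exp (-a * y ^ 2) := by
  have hM : (1 : ℝ) ≤ m := by exact_mod_cast hm
  have hM14 : (m : ℝ) ≤ (m : ℝ) ^ 4 := by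
    simpa using pow_le_pow_right₀ hM (show 1 ≤ 4 by norm_num)
  have hTM : (m : ℝ) ^ 4 ≤ T * (m : ℝ) ^ 4 := le_mul_of_one_le_left (by positivity) hT
  have hn0 : (0 : ℝ) < n := by linarith
  have hn1 : 0 < n := by exact_mod_cast hn0
  have hZ : 0 ≤ Z := (abs_nonneg _).trans hz
  have hcell : cell n (cell n y) = cell n y := cell_intCast_div hn1 _
  have hsymb : gridSymbol n t (cell n y) = gridSymbol n t y := by
    rw [gridSymbol, gridSymbol, gridPsi_apply hn1, gridPsi_apply hn1, hcell]
  have hd : (1 : ℝ) / n ≤ 1 := by rw [div_le_one hn0]; linarith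
  rw [stepFun]
  split_ifs with h
  · obtain ⟨h1, h2⟩ := h
    have hc1 : -(m : ℝ) ≤ cell n y := by
      rw [cell, le_div_iff₀ hn0]
      have : ((-((m : ℤ) * n) : ℤ) : ℝ) ≤ (⌊(n : ℝ) * y⌋ : ℝ) := by exact_mod_cast h1
      push_cast at this
      linarith
    have hc2 : cell n y ≤ m := by
      rw [cell, div_le_iff₀ hn0]
      have : (⌊(n : ℝ) * y⌋ : ℝ) ≤ (((m : ℤ) * n : ℤ) : ℝ) := by
        exact_mod_cast Int.lt_add_one_iff.1 h2
      push_cast at this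
      linarith
    have hc : |cell n y| ≤ m := abs_le.2 ⟨hc1, hc2⟩
    have hcy : |cell n y - y| ≤ 1 / n := by
      rw [abs_sub_comm, abs_of_nonneg (by linarith [cell_le hn1 y])]
      exact sub_cell_le hn1 y
    have hmem : y ∈ Set.Icc (-((m : ℝ) + 1)) (m + 1) := by
      have := abs_le.1 hcy
      constructor <;> linarith
    rw [Set.indicator_of_mem hmem]
    refine le_add_of_le_of_nonneg ?_ (by positivity)
    have e : gridSymbol n t (cell n y) *
          Complex.exp ((Real.pi * cell n y * z : ℝ) * Complex.I)
          - Complex.exp (heatPhase (timeCell n t) z y)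
        = (gridSymbol n t y - Complex.exp (heatPhase (timeCell n t) 0 (cell n y))) *
            Complex.exp ((Real.pi * cell n y * z : ℝ) * Complex.I)
          + (Complex.exp (heatPhase (timeCell n t) z (cell n y))
            - Complex.exp (heatPhase (timeCell n t) z y)) := by
      have : Complex.exp (heatPhase (timeCell n t) z (cell n y)) =
          Complex.exp (heatPhase (timeCell n t) 0 (cell n y)) *
            Complex.exp ((Real.pi * cell n y * z : ℝ) * Complex.I) := by
        rw [← Complex.exp_add]
        simp [heatPhase]
      rw [hsymb, this]
      ring
    rw [e]
    refine (norm_add_le _ _).trans ?_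
    rw [norm_mul, Complex.norm_exp_ofReal_mul_I, mul_one]
    refine (add_le_add (norm_gridSymbol_sub_le hM hT hn ht hc)
      (norm_exp_heatPhase_sub_le ht0 ht hM hz hc hd hcy)).trans ?_
    rw [mul_one_div, ← add_div]
    refine div_le_div_of_nonneg_right ?_ hn0.le
    have : T * m ≤ T * (m : ℝ) ^ 4 := by gcongr
    linarith
  · rw [zero_sub, norm_neg, norm_exp_heatPhase]
    refine le_add_of_nonneg_of_le (Set.indicator_nonneg (fun _ _ => by positivity) _) ?_
    rw [← Real.exp_add, Real.exp_le_exp]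
    have hy : (m : ℝ) ^ 2 ≤ y ^ 2 := by
      rw [← sq_abs y]
      gcongr
      by_contra hlt
      have hlt := abs_lt.1 (not_le.1 hlt)
      refine h ⟨?_, ?_⟩
      · rw [Int.le_floor]; push_cast; nlinarith [hlt.1]
      · rw [Int.floor_lt]; push_cast; nlinarith [hlt.2]
    have h1 : 2 * a * y ^ 2 ≤ Real.pi ^ 2 * timeCell n t * y ^ 2 := by gcongr
    have h2 : a * (m : ℝ) ^ 2 ≤ a * y ^ 2 := by gcongr
    linarith

theorem norm_gridKernel_sub_heatKernel_le {n m : ℕ} {T Z a t z : ℝ} (hm : 1 ≤ m) (hT : 1 ≤ T)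
    (hn : 448 * T * (m : ℝ) ^ 4 ≤ n) (ht : timeCell n t ≤ T) (ht0 : 0 < timeCell n t)
    (hz : |z| ≤ Z) (ha : 2 * a ≤ Real.pi ^ 2 * timeCell n t) (ha0 : 0 < a) :
    ‖gridKernel n m t z - heatKernel (timeCell n t) z‖
      ≤ (m + 1) * ((1392 * T * (m : ℝ) ^ 4 + 4 * Z) / n)
        + Real.exp (-a * (m : ℝ) ^ 2) * Real.sqrt (Real.pi / a) := by
  have hM : (1 : ℝ) ≤ m := by exact_mod_cast hm
  have hn0 : (0 : ℝ) < n := by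
    refine lt_of_lt_of_le ?_ hn
    positivity
  have hn1 : 0 < n := by exact_mod_cast hn0
  have hZ : 0 ≤ Z := (abs_nonneg _).trans hz
  have hint := integrable_stepFun hn1 (-((m : ℤ) * n)) ((m : ℤ) * n + 1)
    (fun y => gridSymbol n t y * Complex.exp ((Real.pi * y * z : ℝ) * Complex.I))
  rw [gridKernel, ← integral_stepFun hn1 _ _
    (fun y => gridSymbol n t y * Complex.exp ((Real.pi * y * z : ℝ) * Complex.I)),
    ← integral_exp_heatPhase ht0, ← mul_sub, ← integral_sub hint (integrable_exp_heatPhase ht0 z),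
    norm_mul]
  have hI1 : Integrable ((Set.Icc (-((m : ℝ) + 1)) (m + 1)).indicator
      (fun _ => (1392 * T * (m : ℝ) ^ 4 + 4 * Z) / n)) := by
    rw [integrable_indicator_iff measurableSet_Icc]
    exact integrableOn_const (by simp)
  have hI2 : Integrable fun y : ℝ => Real.exp (-a * (m : ℝ) ^ 2) * Real.exp (-a * y ^ 2) :=
    (integrable_exp_neg_mul_sq ha0).const_mul _
  have hle := norm_integral_le_of_norm_le (hI1.add hI2) (Eventually.of_forall fun y =>
    norm_stepFun_sub_le hm hT hn ht ht0.le hz ha ha0 y)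
  have hval : ∫ y, ((Set.Icc (-((m : ℝ) + 1)) (m + 1)).indicator
      (fun _ => (1392 * T * (m : ℝ) ^ 4 + 4 * Z) / n) y
      + Real.exp (-a * (m : ℝ) ^ 2) * Real.exp (-a * y ^ 2))
      = 2 * (m + 1) * ((1392 * T * (m : ℝ) ^ 4 + 4 * Z) / n)
        + Real.exp (-a * (m : ℝ) ^ 2) * Real.sqrt (Real.pi / a) := by
    rw [integral_add hI1 hI2, integral_indicator measurableSet_Icc, setIntegral_const,
      integral_const_mul, integral_gaussian, measureReal_def, Real.volume_Icc,
      ENNReal.toReal_ofReal (by linarith), smul_eq_mul]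
    ring
  replace hle := hle.trans_eq hval
  have h12 : ‖(1 / 2 : ℂ)‖ = 1 / 2 := by simp
  rw [h12]
  have : 0 ≤ Real.exp (-a * (m : ℝ) ^ 2) * Real.sqrt (Real.pi / a) := by positivity
  linarith

/-! ## The Riemann sums of the classical solution -/

/-- For large `r` the quotient `B r ^ ρ / r²` is below `ε` since `ρ < 2`; on the remaining compact
interval continuity bounds `g`. -/
theorem exists_norm_le_mul_exp_sq {g : ℝ → ℂ} (hg : Continuous g) {A B ρ : ℝ} (hρ : ρ < 2)
    (hgrowth : ∀ x : ℝ, ‖g x‖ ≤ A * Real.exp (B * |x| ^ ρ)) {ε : ℝ} (hε : 0 < ε) :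
    ∃ C, 0 ≤ C ∧ ∀ x, ‖g x‖ ≤ C * Real.exp (ε * x ^ 2) := by
  have h1 : ∀ᶠ r : ℝ in atTop, B * r ^ ρ ≤ ε * r ^ 2 := by
    have h := ((tendsto_rpow_neg_atTop (sub_pos.2 hρ)).const_mul B).eventually
      (gt_mem_nhds (show B * 0 < ε by simpa using hε))
    filter_upwards [h, eventually_gt_atTop 0] with r hr hr0
    have e : r ^ ρ = r ^ (-(2 - ρ)) * r ^ 2 := by
      rw [← Real.rpow_natCast r 2, ← Real.rpow_add hr0]
      norm_num
    rw [e, ← mul_assoc]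
    gcongr
  obtain ⟨X, hX⟩ := h1.exists_forall_of_atTop
  obtain ⟨K, hK⟩ := (isCompact_Icc (a := -X) (b := X)).exists_bound_of_continuousOn hg.continuousOn
  refine ⟨max |A| |K|, le_max_of_le_left (abs_nonneg _), fun x => ?_⟩
  by_cases hx : |x| ≤ X
  · calc ‖g x‖ ≤ |K| * 1 := by rw [mul_one]; exact (hK x (abs_le.1 hx)).trans (le_abs_self _)
      _ ≤ _ := by
        gcongr
        · exact le_max_right _ _
        · exact Real.one_le_exp (by positivity)
  · have := hX |x| (not_le.1 hx).le
    rw [sq_abs] at this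
    calc ‖g x‖ ≤ |A| * Real.exp (B * |x| ^ ρ) :=
          (hgrowth x).trans (by gcongr; exact le_abs_self _)
      _ ≤ _ := by
        gcongr
        exact le_max_left _ _

/-- A majorant that depends on `y` alone, uniform for `τ ≤ 2 t₀`, `x` near `x₀` and `v` near `y`. In
units of `1 / (64 t₀)` the kernel contributes `-8 (x - v)²` and the growth of `g` only `v²`;
replacing `v` and `x` by `y` and `x₀` still leaves `-2 y²`. -/
theorem exp_mul_norm_le {g : ℝ → ℂ} {C t₀ x₀ : ℝ} (ht₀ : 0 < t₀) (hC : 0 ≤ C)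
    (hgC : ∀ x, ‖g x‖ ≤ C * Real.exp (1 / (64 * t₀) * x ^ 2)) {τ x y v : ℝ}
    (hτ : 0 < τ) (hτ2 : τ ≤ 2 * t₀) (hx : |x - x₀| ≤ 1) (hv : |y - v| ≤ 1) :
    Real.exp (-(x - v) ^ 2 / (4 * τ)) * ‖g v‖ ≤
      C * Real.exp ((|x₀| + 2) ^ 2 / (8 * t₀) + 1 / (32 * t₀)) *
        Real.exp (-(1 / (32 * t₀)) * y ^ 2) := by
  have h1 : y ^ 2 ≤ 2 * (x - v) ^ 2 + 2 * (|x₀| + 2) ^ 2 := by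
    have e : y = -(x - v) + (x₀ + (x - x₀) + (y - v)) := by ring
    have h : |x₀ + (x - x₀) + (y - v)| ≤ |x₀| + 2 := by
      refine (abs_add_le _ _).trans ?_
      linarith [abs_add_le x₀ (x - x₀)]
    have h' : (x₀ + (x - x₀) + (y - v)) ^ 2 ≤ (|x₀| + 2) ^ 2 := by
      rw [← sq_abs (x₀ + (x - x₀) + (y - v))]; gcongr
    set q := x₀ + (x - x₀) + (y - v)
    rw [e]
    nlinarith [sq_nonneg ((x - v) + q)]
  have h2 : v ^ 2 ≤ 2 * y ^ 2 + 2 := by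
    have h' : (y - v) ^ 2 ≤ 1 := by rw [← sq_abs]; exact pow_le_one₀ (abs_nonneg _) hv
    nlinarith [sq_nonneg (y + (y - v))]
  have h3 : -(x - v) ^ 2 / (4 * τ) ≤ -(x - v) ^ 2 / (8 * t₀) := by
    rw [neg_div, neg_div, neg_le_neg_iff]
    apply div_le_div_of_nonneg_left (by positivity) (by positivity) (by linarith)
  calc Real.exp (-(x - v) ^ 2 / (4 * τ)) * ‖g v‖
      ≤ Real.exp (-(x - v) ^ 2 / (8 * t₀)) * (C * Real.exp (1 / (64 * t₀) * v ^ 2)) := by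
        gcongr
        exact hgC v
    _ = C * Real.exp (-(x - v) ^ 2 / (8 * t₀) + 1 / (64 * t₀) * v ^ 2) := by
        rw [Real.exp_add]; ring
    _ ≤ C * Real.exp (((|x₀| + 2) ^ 2 / (8 * t₀) + 1 / (32 * t₀)) + -(1 / (32 * t₀)) * y ^ 2) := by
        refine mul_le_mul_of_nonneg_left (Real.exp_le_exp.2 ?_) hC
        have e1 : -(x - v) ^ 2 / (8 * t₀) + 1 / (64 * t₀) * v ^ 2
          = (-8 * (x - v) ^ 2 + v ^ 2) * (1 / (64 * t₀)) := by field_simp; ring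
        have e2 : ((|x₀| + 2) ^ 2 / (8 * t₀) + 1 / (32 * t₀)) + -(1 / (32 * t₀)) * y ^ 2
          = (8 * (|x₀| + 2) ^ 2 + 2 - 2 * y ^ 2) * (1 / (64 * t₀)) := by field_simp; ring
        rw [e1, e2]
        gcongr
        linarith
    _ = _ := by rw [Real.exp_add]; ring

theorem integrable_heatIntegrand {g : ℝ → ℂ} (hg : Continuous g) {C t₀ : ℝ} (x₀ : ℝ)
    (ht₀ : 0 < t₀) (hC : 0 ≤ C) (hgC : ∀ x, ‖g x‖ ≤ C * Real.exp (1 / (64 * t₀) * x ^ 2)) :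
    Integrable (heatIntegrand g t₀ x₀) := by
  refine Integrable.mono' (((integrable_exp_neg_mul_sq (show 0 < 1 / (32 * t₀) by positivity)).const_mul
    (C * Real.exp ((|x₀| + 2) ^ 2 / (8 * t₀) + 1 / (32 * t₀))))) ?_ (Eventually.of_forall fun y => ?_)
  · refine Continuous.aestronglyMeasurable ?_
    unfold heatIntegrand
    fun_prop
  · rw [heatIntegrand, norm_mul, Complex.norm_real, Real.norm_eq_abs, Real.abs_exp]
    exact exp_mul_norm_le ht₀ hC hgC ht₀ (by linarith) (by simp) (by simp)

theorem classicalSolution_eq_integral (g : ℝ → ℂ) {t₀ : ℝ} (ht₀ : 0 < t₀) (x₀ : ℝ) :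
    classicalSolution g t₀ x₀ = ∫ y, (heatKernel t₀ (x₀ - y) : ℂ) * g y := by
  rw [classicalSolution, if_neg ht₀.ne', ← integral_const_mul]
  refine integral_congr_ae (Eventually.of_forall fun y => ?_)
  simp only [heatIntegrand, heatKernel]
  push_cast
  ring

theorem continuousAt_heatKernel {t₀ z₀ : ℝ} (ht₀ : 0 < t₀) :
    ContinuousAt (fun p : ℝ × ℝ => heatKernel p.1 p.2) (t₀, z₀) := by
  have h : Real.sqrt (4 * Real.pi * t₀) ≠ 0 := by positivity
  have h' : 4 * t₀ ≠ 0 := by positivity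
  unfold heatKernel
  refine ContinuousAt.mul ?_ ?_
  · exact ContinuousAt.div₀ (by fun_prop) (by fun_prop) h
  · refine Real.continuous_exp.continuousAt.comp (ContinuousAt.div₀ (by fun_prop) (by fun_prop) h')

theorem tendsto_cell_of_tendsto {κ : Type*} {l : Filter κ} {n : κ → ℕ} (hn : Tendsto n l atTop)
    {x : κ → ℝ} {x₀ : ℝ} (hx : Tendsto x l (nhds x₀)) :
    Tendsto (fun i => cell (n i) (x i)) l (nhds x₀) := by
  have h : Tendsto (fun i => x i - 1 / (n i : ℝ)) l (nhds (x₀ - 0)) :=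
    hx.sub (tendsto_one_div_atTop_nhds_zero_nat.comp hn)
  rw [sub_zero] at h
  refine tendsto_of_tendsto_of_tendsto_of_le_of_le' h hx ?_ ?_
  · filter_upwards [hn.eventually_gt_atTop 0] with i hi
    linarith [sub_cell_le hi (x i)]
  · filter_upwards [hn.eventually_gt_atTop 0] with i hi
    exact cell_le hi (x i)

theorem tendsto_integral_stepFun {κ : Type*} {l : Filter κ} [l.IsCountablyGenerated]
    {g : ℝ → ℂ} (hg : Continuous g) {C t₀ x₀ : ℝ} (ht₀ : 0 < t₀) (hC : 0 ≤ C)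
    (hgC : ∀ x, ‖g x‖ ≤ C * Real.exp (1 / (64 * t₀) * x ^ 2))
    {n w : κ → ℕ} {τ x : κ → ℝ} (hn : Tendsto n l atTop) (hw : Tendsto w l atTop)
    (hτ : Tendsto τ l (nhds t₀)) (hx : Tendsto x l (nhds x₀)) :
    Tendsto (fun i => ∫ y, stepFun (n i) (-((w i : ℤ) * n i)) ((w i : ℤ) * n i)
      (fun v => (heatKernel (τ i) (x i - v) : ℂ) * g v) y) l (nhds (classicalSolution g t₀ x₀)) := by
  rw [classicalSolution_eq_integral g ht₀]
  refine tendsto_integral_filter_of_dominated_convergence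
    (fun y => 1 / Real.sqrt (2 * Real.pi * t₀) *
      (C * Real.exp ((|x₀| + 2) ^ 2 / (8 * t₀) + 1 / (32 * t₀)) *
        Real.exp (-(1 / (32 * t₀)) * y ^ 2))) ?_ ?_ ?_ ?_
  · filter_upwards [hn.eventually_gt_atTop 0] with i hi
    exact (integrable_stepFun hi _ _ _).aestronglyMeasurable
  · filter_upwards [hn.eventually_gt_atTop 0, hτ.eventually (lt_mem_nhds (show t₀ / 2 < t₀ by linarith)),
      hτ.eventually (gt_mem_nhds (show t₀ < 2 * t₀ by linarith)),
      hx.eventually (Metric.closedBall_mem_nhds x₀ one_pos)] with i hi h1 h2 h3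
    refine Eventually.of_forall fun y => ?_
    rw [stepFun]
    split_ifs
    · rw [norm_mul, Complex.norm_real, Real.norm_eq_abs, heatKernel, abs_mul, Real.abs_exp,
        abs_of_nonneg (by positivity), mul_assoc]
      have hτ0 : 0 < τ i := by linarith
      have hn1 : (1 : ℝ) / n i ≤ 1 := by
        rw [div_le_one (by positivity)]; exact_mod_cast hi
      have hv : |y - cell (n i) y| ≤ 1 := by
        rw [abs_of_nonneg (by linarith [cell_le hi y])]
        exact (sub_cell_le hi y).trans hn1
      refine mul_le_mul ?_ (exp_mul_norm_le ht₀ hC hgC hτ0 h2.le h3 hv) (by positivity)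
        (by positivity)
      refine one_div_le_one_div_of_le (by positivity) (Real.sqrt_le_sqrt ?_)
      nlinarith [Real.pi_pos]
    · rw [norm_zero]; positivity
  · exact ((integrable_exp_neg_mul_sq (by positivity)).const_mul _).const_mul _
  · refine Eventually.of_forall fun y => ?_
    have hc := tendsto_cell_of_tendsto hn (tendsto_const_nhds (x := y))
    have h : Tendsto (fun i => (heatKernel (τ i) (x i - cell (n i) y) : ℂ) * g (cell (n i) y)) l
        (nhds ((heatKernel t₀ (x₀ - y) : ℂ) * g y)) := by
      refine Tendsto.mul ?_ ((hg.tendsto y).comp hc)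
      refine (Complex.continuous_ofReal.tendsto _).comp ?_
      exact Tendsto.comp (continuousAt_heatKernel ht₀) (hτ.prodMk_nhds (hx.sub hc))
    refine h.congr' ?_
    filter_upwards [hn.eventually_gt_atTop 0,
      (tendsto_natCast_atTop_atTop.comp hw).eventually_gt_atTop |y|] with i hi hwi
    have hi' : (0 : ℝ) < n i := by positivity
    have hwi := abs_lt.1 hwi
    simp only [Function.comp_apply] at hwi
    rw [stepFun, if_pos]
    constructor
    · rw [Int.le_floor]; push_cast; nlinarith [hwi.1]
    · rw [Int.floor_lt]; push_cast; nlinarith [hwi.2]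

/-- The Riemann sums of the classical solution converge along every filter. -/
theorem tendsto_sum_heatKernel {κ : Type*} {l : Filter κ}
    {g : ℝ → ℂ} (hg : Continuous g) {C t₀ x₀ : ℝ} (ht₀ : 0 < t₀) (hC : 0 ≤ C)
    (hgC : ∀ x, ‖g x‖ ≤ C * Real.exp (1 / (64 * t₀) * x ^ 2))
    {n w : κ → ℕ} {τ x : κ → ℝ} (hn : Tendsto n l atTop) (hw : Tendsto w l atTop)
    (hτ : Tendsto τ l (nhds t₀)) (hx : Tendsto x l (nhds x₀)) :
    Tendsto (fun i => (1 / (n i : ℂ)) * ∑ k ∈ Finset.Ico (-((w i : ℤ) * n i)) ((w i : ℤ) * n i),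
      (heatKernel (τ i) (x i - k / n i) : ℂ) * g (k / n i)) l
      (nhds (classicalSolution g t₀ x₀)) := by
  -- Dominated convergence needs a countably generated filter, which `l` need not be. It is applied
  -- to the parameters themselves, on a product of `atTop` and neighbourhood filters, and then
  -- composed with the given families.
  have h := tendsto_integral_stepFun
    (l := (atTop : Filter ℕ) ×ˢ (atTop : Filter ℕ) ×ˢ nhds t₀ ×ˢ nhds x₀) hg ht₀ hC hgC
    tendsto_fst (tendsto_fst.comp tendsto_snd)
    (tendsto_fst.comp (tendsto_snd.comp tendsto_snd))
    (tendsto_snd.comp (tendsto_snd.comp tendsto_snd))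
  refine (h.comp (hn.prodMk (hw.prodMk (hτ.prodMk hx)))).congr' ?_
  filter_upwards [hn.eventually_gt_atTop 0] with i hi
  exact integral_stepFun hi _ _ _

theorem timeCell_eq_cell {n : ℕ} {t : ℝ} (ht : 0 ≤ t) : timeCell n t = cell n t := by
  rw [timeCell, cell, natCast_floor_eq_intCast_floor (by positivity)]

/-! ## Comparison of the truncated kernel with the heat kernel -/

/-- There are `2 w n` nodes of weight `1 / n`, and at each of them `|g|` is at most `C exp (w²)`. -/
theorem norm_sum_sub_mul_le {n w : ℕ} (hn : 0 < n) {K G : ℝ → ℂ} {g : ℝ → ℂ} {C δ : ℝ}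
    (hgC : ∀ x, ‖g x‖ ≤ C * Real.exp (1 * x ^ 2))
    (hC : 0 ≤ C) (hδ : ∀ v : ℝ, |v| ≤ w → ‖K v - G v‖ ≤ δ) :
    ‖(1 / (n : ℂ)) * ∑ k ∈ Finset.Ico (-((w : ℤ) * n)) ((w : ℤ) * n), K (k / n) * g (k / n) -
      (1 / (n : ℂ)) * ∑ k ∈ Finset.Ico (-((w : ℤ) * n)) ((w : ℤ) * n), G (k / n) * g (k / n)‖
      ≤ 2 * w * (δ * (C * Real.exp ((w : ℝ) ^ 2))) := by
  have hn' : (0 : ℝ) < n := by positivity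
  rw [← mul_sub, ← Finset.sum_sub_distrib, norm_mul]
  have hterm : ∀ k ∈ Finset.Ico (-((w : ℤ) * n)) ((w : ℤ) * n),
      ‖K (k / n) * g (k / n) - G (k / n) * g (k / n)‖ ≤ δ * (C * Real.exp ((w : ℝ) ^ 2)) := by
    intro k hk
    rw [Finset.mem_Ico] at hk
    have hk1 : -((w : ℝ) * n) ≤ k := by exact_mod_cast hk.1
    have hk2 : (k : ℝ) ≤ w * n := by exact_mod_cast hk.2.le
    have hv : |(k : ℝ) / n| ≤ w := by
      rw [abs_le, le_div_iff₀ hn', div_le_iff₀ hn']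
      constructor <;> linarith
    have hd := hδ _ hv
    rw [← sub_mul, norm_mul]
    refine mul_le_mul hd ((hgC _).trans ?_) (norm_nonneg _) ((norm_nonneg _).trans hd)
    rw [one_mul, ← sq_abs]
    gcongr
  refine (mul_le_mul_of_nonneg_left (norm_sum_le_of_le _ hterm) (norm_nonneg _)).trans_eq ?_
  have h1 : ‖(1 / (n : ℂ))‖ = 1 / n := by simp
  have h2 : ((w : ℤ) * n - -((w : ℤ) * n)).toNat = 2 * w * n := by
    have : (w : ℤ) * n - -((w : ℤ) * n) = ((2 * w * n : ℕ) : ℤ) := by push_cast; ring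
    rw [this, Int.toNat_natCast]
  rw [Finset.sum_const, Int.card_Ico, h1, h2, nsmul_eq_mul]
  push_cast
  field_simp

theorem tendsto_pow_mul_exp_sub_sq {a : ℝ} (ha : 0 < a) (k : ℕ) :
    Tendsto (fun r : ℝ => r ^ k * Real.exp (r - a * r ^ 2)) atTop (nhds 0) := by
  refine tendsto_of_tendsto_of_tendsto_of_le_of_le' tendsto_const_nhds
    (Real.tendsto_pow_mul_exp_neg_atTop_nhds_zero k) ?_ ?_
  · filter_upwards [eventually_ge_atTop 0] with r hr
    positivity
  · filter_upwards [eventually_ge_atTop 0, eventually_ge_atTop (2 / a)] with r hr hr2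
    gcongr
    have : 2 ≤ a * r := by rwa [div_le_iff₀' ha] at hr2
    nlinarith

/-- This is where the relative sizes of the infinite numbers enter: `1 / n ≤ exp (-m²) ≤ exp (-a
m²)`, `exp (w²) ≤ exp m` and `w ≤ m`. -/
theorem kernel_error_le {m n T R a D C w : ℝ} (hm : 1 ≤ m) (hn : Real.exp (m ^ 2) ≤ n)
    (hwm : w ^ 2 ≤ m) (hT : 0 ≤ T) (hR : 0 ≤ R) (ha1 : a ≤ 1) (hD : 0 ≤ D) (hC : 0 ≤ C) :
    2 * w * (((m + 1) * ((1392 * T * m ^ 4 + 4 * ((1 + R) * m)) / n)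
        + Real.exp (-a * m ^ 2) * D) * (C * Real.exp (w ^ 2))) ≤
      2 * C * (2 * (1392 * T + 4 * (1 + R)) + D) * (m ^ 6 * Real.exp (m - a * m ^ 2)) := by
  have hm0 : 0 ≤ m := by linarith
  have hw' : w ≤ m := by nlinarith [sq_nonneg (w - 1)]
  have hm4 : m ≤ m ^ 4 := by simpa using pow_le_pow_right₀ hm (show 1 ≤ 4 by norm_num)
  have hm5 : (1 : ℝ) ≤ m ^ 5 := one_le_pow₀ hm
  set P := 1392 * T + 4 * (1 + R) with hP
  have hP0 : 0 ≤ P := by positivity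
  have h1 : 1 / n ≤ Real.exp (-a * m ^ 2) := by
    calc 1 / n ≤ 1 / Real.exp (m ^ 2) := one_div_le_one_div_of_le (Real.exp_pos _) hn
      _ = Real.exp (-m ^ 2) := by rw [one_div, ← Real.exp_neg]
      _ ≤ _ := by
        refine Real.exp_le_exp.2 ?_
        have : a * m ^ 2 ≤ 1 * m ^ 2 := by gcongr
        linarith
  have h2 : 1392 * T * m ^ 4 + 4 * ((1 + R) * m) ≤ P * m ^ 4 := by
    have : 4 * ((1 + R) * m) ≤ 4 * ((1 + R) * m ^ 4) := by gcongr
    rw [hP]; linarith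
  have h3 : (m + 1) * ((1392 * T * m ^ 4 + 4 * ((1 + R) * m)) / n)
      ≤ (2 * m) * (P * m ^ 4 * Real.exp (-a * m ^ 2)) := by
    rw [div_eq_mul_one_div]
    have hn0 : 0 ≤ 1 / n := by have := (Real.exp_pos _).trans_le hn; positivity
    gcongr
    linarith
  have h4 : Real.exp (-a * m ^ 2) * D ≤ Real.exp (-a * m ^ 2) * D * m ^ 5 :=
    le_mul_of_one_le_right (by positivity) hm5
  have h5 : Real.exp (w ^ 2) ≤ Real.exp m := Real.exp_le_exp.2 hwm
  have e : Real.exp (m - a * m ^ 2) = Real.exp m * Real.exp (-a * m ^ 2) := by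
    rw [← Real.exp_add]; ring_nf
  calc _ ≤ 2 * m * (((2 * m) * (P * m ^ 4 * Real.exp (-a * m ^ 2))
          + Real.exp (-a * m ^ 2) * D * m ^ 5) * (C * Real.exp m)) := by
        have hn0 : 0 < n := (Real.exp_pos _).trans_le hn
        gcongr
    _ = _ := by rw [e]; ring

theorem tendsto_sum_gridKernel {κ : Type*} {l : Filter κ} {g : ℝ → ℂ} (hg : Continuous g)
    {A B ρ : ℝ} (hρ : ρ < 2) (hgrowth : ∀ x : ℝ, ‖g x‖ ≤ A * Real.exp (B * |x| ^ ρ))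
    {t₀ x₀ : ℝ} (ht₀ : 0 < t₀)
    {n w m : κ → ℕ} {t x : κ → ℝ} (hn : Tendsto n l atTop) (hw : Tendsto w l atTop)
    (hm : Tendsto m l atTop) (hwm : ∀ᶠ i in l, (w i : ℝ) < Real.sqrt (m i))
    (hmn : ∀ᶠ i in l, (m i : ℝ) < Real.sqrt (Real.log (n i)))
    (ht : Tendsto t l (nhds t₀)) (hx : Tendsto x l (nhds x₀)) :
    Tendsto (fun i => (1 / (n i : ℂ)) * ∑ k ∈ Finset.Ico (-((w i : ℤ) * n i)) ((w i : ℤ) * n i),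
      gridKernel (n i) (m i) (t i) (cell (n i) (x i) - k / n i) * g (k / n i)) l
      (nhds (classicalSolution g t₀ x₀)) := by
  obtain ⟨C₁, hC₁, hg₁⟩ := exists_norm_le_mul_exp_sq hg hρ hgrowth
    (show 0 < 1 / (64 * t₀) by positivity)
  obtain ⟨C, hC, hgC⟩ := exists_norm_le_mul_exp_sq hg hρ hgrowth one_pos
  have hτ : Tendsto (fun i => timeCell (n i) (t i)) l (nhds t₀) := by
    refine (tendsto_cell_of_tendsto hn ht).congr' ?_
    filter_upwards [ht.eventually (lt_mem_nhds ht₀)] with i hi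
    rw [timeCell_eq_cell hi.le]
  have hξ := tendsto_cell_of_tendsto hn hx
  have hmain := tendsto_sum_heatKernel hg ht₀ hC₁ hg₁ hn hw hτ hξ
  rw [← tendsto_sub_nhds_zero_iff] at hmain
  rw [← tendsto_sub_nhds_zero_iff]
  set T : ℝ := 2 * t₀ + 1 with hT
  set R : ℝ := |x₀| + 1 with hR
  -- The bound by `t₀` gives `2 a ≤ π² τ` once `τ > t₀ / 2`; the bound by `1` lets `exp (-a m²)`
  -- absorb `1 / n`.
  set a : ℝ := min 1 t₀ with ha
  have ha0 : 0 < a := lt_min one_pos ht₀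
  have hmr : Tendsto (fun i => (m i : ℝ)) l atTop := tendsto_natCast_atTop_atTop.comp hm
  have herr := ((tendsto_pow_mul_exp_sub_sq ha0 6).comp hmr).const_mul
    (2 * C * (2 * (1392 * T + 4 * (1 + R)) + Real.sqrt (Real.pi / a)))
  rw [mul_zero] at herr
  -- This will give `448 T m⁴ ≤ exp (m²) ≤ n`, as the symbol estimate requires.
  have hsmall : ∀ᶠ i in l, (m i : ℝ) ^ 4 * Real.exp (m i - 1 * (m i : ℝ) ^ 2) < 1 / (448 * T) :=
    ((tendsto_pow_mul_exp_sub_sq one_pos 4).comp hmr).eventually (gt_mem_nhds (by positivity))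
  have hdiff := squeeze_zero_norm' (f := fun i =>
    (1 / (n i : ℂ)) * ∑ k ∈ Finset.Ico (-((w i : ℤ) * n i)) ((w i : ℤ) * n i),
      gridKernel (n i) (m i) (t i) (cell (n i) (x i) - k / n i) * g (k / n i) -
    (1 / (n i : ℂ)) * ∑ k ∈ Finset.Ico (-((w i : ℤ) * n i)) ((w i : ℤ) * n i),
      (heatKernel (timeCell (n i) (t i)) (cell (n i) (x i) - k / n i) : ℂ) * g (k / n i))
    ?_ herr
  · simpa using hdiff.add hmain
  · filter_upwards [hn.eventually_gt_atTop 0, hm.eventually_ge_atTop 1, hwm, hmn, hsmall,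
      hτ.eventually (lt_mem_nhds (show t₀ / 2 < t₀ by linarith)),
      hτ.eventually (gt_mem_nhds (show t₀ < 2 * t₀ by linarith)),
      hξ.eventually (Metric.closedBall_mem_nhds x₀ one_pos)]
      with i hni hmi hwmi hmni hsi hτ1 hτ2 hxi
    have hm1 : (1 : ℝ) ≤ m i := by exact_mod_cast hmi
    have hn0 : (0 : ℝ) < n i := by exact_mod_cast hni
    have hexp : Real.exp ((m i : ℝ) ^ 2) ≤ n i := by
      rw [Real.lt_sqrt (by positivity)] at hmni
      exact (Real.lt_log_iff_exp_lt hn0).1 hmni |>.le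
    have hw2 : (w i : ℝ) ^ 2 ≤ m i := by
      rw [Real.lt_sqrt (by positivity)] at hwmi
      exact hwmi.le
    have hwle : (w i : ℝ) ≤ m i := by nlinarith [sq_nonneg ((w i : ℝ) - 1)]
    have hnT : 448 * T * (m i : ℝ) ^ 4 ≤ n i := by
      refine le_trans ?_ hexp
      have h1 : Real.exp (-(m i : ℝ) ^ 2) ≤ Real.exp (m i - 1 * (m i : ℝ) ^ 2) :=
        Real.exp_le_exp.2 (by linarith)
      have h2 : (m i : ℝ) ^ 4 * Real.exp (-(m i : ℝ) ^ 2) ≤ 1 / (448 * T) :=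
        (mul_le_mul_of_nonneg_left h1 (by positivity)).trans hsi.le
      rw [Real.exp_neg, ← div_eq_mul_inv, div_le_div_iff₀ (Real.exp_pos _) (by positivity)] at h2
      linarith
    have hkernel : ∀ v : ℝ, |v| ≤ w i →
        ‖gridKernel (n i) (m i) (t i) (cell (n i) (x i) - v)
          - (heatKernel (timeCell (n i) (t i)) (cell (n i) (x i) - v) : ℂ)‖ ≤
        ((m i : ℝ) + 1) * ((1392 * T * (m i : ℝ) ^ 4 + 4 * ((1 + R) * m i)) / n i)
          + Real.exp (-a * (m i : ℝ) ^ 2) * Real.sqrt (Real.pi / a) := by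
      intro v hv
      refine norm_gridKernel_sub_heatKernel_le hmi (by linarith) hnT (by linarith) (by linarith)
        ?_ ?_ ha0
      · have h1 : |cell (n i) (x i)| ≤ R := by
          have := abs_add_le x₀ (cell (n i) (x i) - x₀)
          rw [add_sub_cancel] at this
          refine this.trans ?_
          rw [hR]
          gcongr
          exact hxi
        have hR0 : 0 ≤ R := by positivity
        calc |cell (n i) (x i) - v| ≤ |cell (n i) (x i)| + |v| := abs_sub _ _
          _ ≤ R * 1 + m i := by linarith
          _ ≤ R * m i + m i := by gcongr
          _ = _ := by ring
      · have h1 : a ≤ t₀ := min_le_right _ _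
        have h2 : 9 ≤ Real.pi ^ 2 := by nlinarith [Real.pi_gt_three]
        calc 2 * a ≤ 9 * (t₀ / 2) := by linarith
          _ ≤ Real.pi ^ 2 * timeCell (n i) (t i) := by gcongr
    exact (norm_sum_sub_mul_le hni (K := fun v => gridKernel (n i) (m i) (t i) (cell (n i) (x i) - v))
      (G := fun v => (heatKernel (timeCell (n i) (t i)) (cell (n i) (x i) - v) : ℂ)) hgC hC hkernel).trans
      (kernel_error_le hm1 hexp hw2 (by positivity) (by positivity) (min_le_left _ _)
        (by positivity) hC)

/-! ## The discrete heat equation -/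

/-- The forward difference of a function on the grid. -/
def intDx (n : ℕ) (v : ℤ → ℂ) (j : ℤ) : ℂ :=
  if j ≤ (n : ℤ) ^ 2 - 2 then (n : ℂ) * (v (j + 1) - v j) else 0

/-- The solution of the discrete heat equation on the grid. -/
def gridSol (n : ℕ) (b : ℤ → ℂ) : ℕ → ℤ → ℂ
  | 0 => b
  | k + 1 => fun j => gridSol n b k j + (1 / (n : ℂ)) * intDx n (intDx n (gridSol n b k)) j

/-- `f` is a measurable solution of the discrete heat equation with initial data `b`. -/
structure IsGridSolution (n : ℕ) (b : ℝ → ℂ) (f : ℝ → ℝ → ℂ) : Prop where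
  measurable : CellMeasurable n f
  heat : ∀ t x : ℝ, 0 ≤ t → t < ((n : ℝ) ^ 2 - 1) / n → -(n : ℝ) ≤ x → x < n →
    discreteDt n f t x - discreteDx n (discreteDx n f) t x = 0
  initial : ∀ x : ℝ, -(n : ℝ) ≤ x → x < n → f 0 x = b x

theorem discreteDx_eq_intDx (n : ℕ) (f : ℝ → ℝ → ℂ) (t x : ℝ) :
    discreteDx n f t x = intDx n (fun j => f t ((j : ℝ) / n)) ⌊(n : ℝ) * x⌋ := by
  simp only [discreteDx, intDx]
  push_cast
  rfl

theorem discreteDx_discreteDx {n : ℕ} (hn : 0 < n) (f : ℝ → ℝ → ℂ) (t x : ℝ) :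
    discreteDx n (discreteDx n f) t x =
      intDx n (intDx n (fun j => f t ((j : ℝ) / n))) ⌊(n : ℝ) * x⌋ := by
  rw [discreteDx_eq_intDx]
  congr 1
  funext j
  rw [discreteDx_eq_intDx, floor_mul_div hn]

theorem floor_le_sq_sub_two {n : ℕ} (hn : 0 < n) {t : ℝ} (h : t < ((n : ℝ) ^ 2 - 1) / n) :
    ⌊(n : ℝ) * t⌋ ≤ (n : ℤ) ^ 2 - 2 := by
  have hn' : (0 : ℝ) < n := by positivity
  rw [lt_div_iff₀ hn'] at h
  have : ⌊(n : ℝ) * t⌋ < (n : ℤ) ^ 2 - 1 := by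
    rw [Int.floor_lt]; push_cast; linarith
  omega

/-- The value `0` on the last cell keeps the difference from reading beyond the right end of the
grid, so it is determined by the values on the grid. -/
theorem intDx_congr {n : ℕ} {u v : ℤ → ℂ} {a : ℤ} (h : ∀ j, a ≤ j → j < (n : ℤ) ^ 2 → u j = v j)
    {j : ℤ} (h1 : a ≤ j) (h2 : j < (n : ℤ) ^ 2) : intDx n u j = intDx n v j := by
  rw [intDx, intDx]
  split_ifs with hj
  · rw [h j h1 h2, h (j + 1) (by omega) (by omega)]
  · rfl

theorem exists_isGridSolution {n : ℕ} (hn : 0 < n) {b : ℝ → ℂ}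
    (hb : ∀ x, -(n : ℝ) ≤ x → x < n → b x = b (cell n x)) :
    IsGridSolution n b
      (fun t x => gridSol n (fun j => b ((j : ℝ) / n)) ⌊(n : ℝ) * t⌋.toNat ⌊(n : ℝ) * x⌋) := by
  have hn' : (n : ℝ) ≠ 0 := by positivity
  have hnc : (n : ℂ) ≠ 0 := by exact_mod_cast hn.ne'
  refine ⟨fun t x _ _ _ _ => ?_, fun t x ht0 ht _ _ => ?_, fun x hx1 hx2 => ?_⟩
  · simp only [floor_mul_cell hn]
  · have h0 : 0 ≤ ⌊(n : ℝ) * t⌋ := Int.floor_nonneg.2 (by positivity)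
    rw [discreteDx_discreteDx hn, discreteDt, if_pos (floor_le_sq_sub_two hn ht)]
    have h1 : ⌊(n : ℝ) * (((⌊(n : ℝ) * t⌋ : ℝ) + 1) / n)⌋ = ⌊(n : ℝ) * t⌋ + 1 := by
      have := floor_mul_div hn (⌊(n : ℝ) * t⌋ + 1)
      push_cast at this
      exact this
    have h2 : (⌊(n : ℝ) * t⌋ + 1).toNat = ⌊(n : ℝ) * t⌋.toNat + 1 := by omega
    simp only [h1, h2, floor_mul_div hn, gridSol]
    field_simp
    ring
  · simp only [mul_zero, Int.floor_zero, Int.toNat_zero, gridSol]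
    exact (hb x hx1 hx2).symm

/-- The equation at time `k / n` determines the values at time `(k + 1) / n`. Since only the last
time cell is exempt from it, the induction reaches every time of the grid. -/
theorem IsGridSolution.apply_div {n : ℕ} (hn : 0 < n) {b : ℝ → ℂ} {f : ℝ → ℝ → ℂ}
    (hf : IsGridSolution n b f) {k : ℕ} (hk : (k : ℤ) < (n : ℤ) ^ 2) {j : ℤ}
    (h1 : -(n : ℤ) ^ 2 ≤ j) (h2 : j < (n : ℤ) ^ 2) :
    f ((k : ℝ) / n) ((j : ℝ) / n) = gridSol n (fun j => b ((j : ℝ) / n)) k j := by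
  have hn' : (0 : ℝ) < n := by positivity
  have hnc : (n : ℂ) ≠ 0 := by exact_mod_cast hn.ne'
  have hx1 : ∀ j : ℤ, -(n : ℤ) ^ 2 ≤ j → -(n : ℝ) ≤ (j : ℝ) / n := fun j h => by
    have : (-(n : ℝ) ^ 2) ≤ j := by exact_mod_cast h
    rw [le_div_iff₀ hn']; linarith
  have hx2 : ∀ j : ℤ, j < (n : ℤ) ^ 2 → (j : ℝ) / n < n := fun j h => by
    have : (j : ℝ) < (n : ℝ) ^ 2 := by exact_mod_cast h
    rw [div_lt_iff₀ hn']; linarith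
  induction k generalizing j with
  | zero =>
    rw [Nat.cast_zero, zero_div, hf.initial _ (hx1 j h1) (hx2 j h2), gridSol]
  | succ k ih =>
    have ih' : ∀ i : ℤ, -(n : ℤ) ^ 2 ≤ i → i < (n : ℤ) ^ 2 →
        f ((k : ℝ) / n) ((i : ℝ) / n) = gridSol n (fun j => b ((j : ℝ) / n)) k i :=
      fun i => ih (by push_cast at hk; omega)
    have hk' : (k : ℝ) + 1 < (n : ℝ) ^ 2 := by exact_mod_cast hk
    have hkt : (k : ℝ) / n < ((n : ℝ) ^ 2 - 1) / n := by gcongr; linarith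
    have h := hf.heat ((k : ℝ) / n) ((j : ℝ) / n) (by positivity) hkt (hx1 j h1) (hx2 j h2)
    have hfl : ⌊(n : ℝ) * ((k : ℝ) / n)⌋ = (k : ℤ) := by
      simpa using floor_mul_div hn (k : ℤ)
    rw [discreteDx_discreteDx hn, floor_mul_div hn, discreteDt, hfl,
      if_pos (by push_cast at hk; omega), Int.cast_natCast, ih' j h1 h2,
      intDx_congr (v := intDx n (gridSol n (fun j => b ((j : ℝ) / n)) k))
        (fun i hi1 hi2 => intDx_congr ih' hi1 hi2) h1 h2] at h
    simp only [gridSol]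
    rw [← sub_eq_zero.1 h]
    push_cast
    field_simp
    ring

theorem IsGridSolution.apply {n : ℕ} (hn : 0 < n) {b : ℝ → ℂ} {f : ℝ → ℝ → ℂ}
    (hf : IsGridSolution n b f) {t x : ℝ} (ht0 : 0 ≤ t) (ht : t < n) (hx1 : -(n : ℝ) ≤ x)
    (hx2 : x < n) :
    f t x = gridSol n (fun j => b ((j : ℝ) / n)) ⌊(n : ℝ) * t⌋₊ ⌊(n : ℝ) * x⌋ := by
  have hn' : (0 : ℝ) < n := by positivity
  rw [hf.measurable t x ht0 ht hx1 hx2, ← timeCell_eq_cell ht0, timeCell, cell]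
  refine hf.apply_div hn ?_ ?_ ?_
  · have : ⌊(n : ℝ) * t⌋₊ < n ^ 2 := by
      rw [Nat.floor_lt (by positivity)]; push_cast; nlinarith
    exact_mod_cast this
  · rw [Int.le_floor]; push_cast; nlinarith
  · rw [Int.floor_lt]; push_cast; nlinarith

/-! ## The Fourier transform of the discrete solution -/

/-- `v` vanishes outside `[a, b)`. -/
def SupportedIn (v : ℤ → ℂ) (a b : ℤ) : Prop := ∀ j, ¬(a ≤ j ∧ j < b) → v j = 0

/-- A forward difference at `j` reads `j` and `j + 1`, so the support grows only to the left. -/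
theorem SupportedIn.intDx {n : ℕ} {v : ℤ → ℂ} {a b : ℤ} (hv : SupportedIn v a b) :
    SupportedIn (intDx n v) (a - 1) b := by
  intro j hj
  rw [NSHeat.intDx]
  split_ifs
  · rw [hv j (by omega), hv (j + 1) (by omega), sub_zero, mul_zero]
  · rfl

theorem SupportedIn.gridSol {n : ℕ} {v : ℤ → ℂ} {a b : ℤ} (hv : SupportedIn v a b) (k : ℕ) :
    SupportedIn (gridSol n v k) (a - 2 * k) b := by
  induction k with
  | zero => simpa [NSHeat.gridSol] using hv
  | succ k ih =>
    intro j hj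
    push_cast at hj
    simp only [NSHeat.gridSol]
    rw [ih j (by omega), ih.intDx.intDx j (by omega), mul_zero, add_zero]

/-- The character `j ↦ exp (-π i c j / n)`. -/
def gridChar (n : ℕ) (c : ℝ) (j : ℤ) : ℂ :=
  Complex.exp (-(Real.pi * Complex.I * (((j : ℝ) / n : ℝ) : ℂ) * c))

theorem gridChar_eq (n : ℕ) (c : ℝ) (j : ℤ) :
    gridChar n c j = Complex.exp ((Real.pi * c / n : ℝ) * Complex.I) * gridChar n c (j + 1) := by
  rw [gridChar, gridChar, ← Complex.exp_add]
  congr 1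
  push_cast
  ring

theorem tsum_mul_gridChar {v : ℤ → ℂ} {a b : ℤ} (hv : SupportedIn v a b) (n : ℕ) (c : ℝ) :
    ∑' j, v j * gridChar n c j = ∑ j ∈ Finset.Ico a b, v j * gridChar n c j :=
  tsum_eq_sum fun j hj => by rw [hv j (by simpa using hj), zero_mul]

theorem SupportedIn.summable {v : ℤ → ℂ} {a b : ℤ} (hv : SupportedIn v a b) (n : ℕ) (c : ℝ) :
    Summable fun j => v j * gridChar n c j :=
  summable_of_ne_finset_zero (s := Finset.Ico a b)
    fun j hj => by rw [hv j (by simpa using hj), zero_mul]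

/-- Summing over all of `ℤ`, the shift by one is a bijection and costs a factor of the character. As
`b < n²`, both values of `v` read on the last cell or beyond are already `0`, so the default value
of the difference does no harm. -/
theorem tsum_intDx {n : ℕ} {v : ℤ → ℂ} {a b : ℤ} (hv : SupportedIn v a b)
    (hb : b < (n : ℤ) ^ 2) (c : ℝ) :
    ∑' j, intDx n v j * gridChar n c j =
      n * (Complex.exp ((Real.pi * c / n : ℝ) * Complex.I) - 1) * ∑' j, v j * gridChar n c j := by
  set p := Complex.exp ((Real.pi * c / n : ℝ) * Complex.I) with hp
  have hs := hv.summable n c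
  have hs' : Summable fun j => v (j + 1) * gridChar n c (j + 1) :=
    (Equiv.addRight (1 : ℤ)).summable_iff.2 hs
  have hshift : ∑' j, v (j + 1) * gridChar n c (j + 1) = ∑' j, v j * gridChar n c j :=
    (Equiv.addRight (1 : ℤ)).tsum_eq fun j => v j * gridChar n c j
  have e : ∀ j, intDx n v j * gridChar n c j =
      n * p * (v (j + 1) * gridChar n c (j + 1)) - n * (v j * gridChar n c j) := by
    intro j
    have : intDx n v j = n * (v (j + 1) - v j) := by
      rw [intDx]
      split_ifs with h
      · rfl
      · rw [hv j (by omega), hv (j + 1) (by omega), sub_zero, mul_zero]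
    rw [this, mul_sub, sub_mul]
    nth_rewrite 1 [gridChar_eq n c j]
    ring
  rw [tsum_congr e, (hs'.mul_left _).tsum_sub (hs.mul_left _), tsum_mul_left, tsum_mul_left, hshift]
  ring

theorem tsum_gridSol {n : ℕ} (hn : 0 < n) {v : ℤ → ℂ} {a b : ℤ} (hv : SupportedIn v a b)
    (hb : b < (n : ℤ) ^ 2) (y : ℝ) (k : ℕ) :
    ∑' j, gridSol n v k j * gridChar n (cell n y) j =
      (1 + gridPsi n y ^ 2 / (n : ℂ)) ^ k * ∑' j, v j * gridChar n (cell n y) j := by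
  induction k with
  | zero => simp [gridSol]
  | succ k ih =>
    have hk := hv.gridSol (n := n) k
    have e : ∀ j, gridSol n v (k + 1) j * gridChar n (cell n y) j =
        gridSol n v k j * gridChar n (cell n y) j +
          1 / (n : ℂ) * (intDx n (intDx n (gridSol n v k)) j * gridChar n (cell n y) j) := by
      intro j; simp only [gridSol]; ring
    rw [tsum_congr e, (hk.summable n _).tsum_add ((hk.intDx.intDx.summable n _).mul_left _),
      tsum_mul_left, tsum_intDx hk.intDx hb, tsum_intDx hk hb, ih, gridPsi_apply hn]
    ring

theorem gridFourier_eq {n : ℕ} (hn : 0 < n) (f : ℝ → ℂ) (y : ℝ) :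
    gridFourier n f y = (1 / (n : ℂ)) *
      ∑ j ∈ Finset.Ico (-(n : ℤ) ^ 2) ((n : ℤ) ^ 2), f ((j : ℝ) / n) * gridChar n (cell n y) j := by
  simp only [gridFourier, gridIntegral, gridExpNeg, gridChar, cell_intCast_div hn]

theorem SupportedIn.mono {v : ℤ → ℂ} {a b a' b' : ℤ} (hv : SupportedIn v a b) (ha : a' ≤ a)
    (hb : b ≤ b') : SupportedIn v a' b' := fun j hj => hv j (by omega)

/-- The conditions on `c` and `d` keep the support inside the grid up to time `t`, so the finite
sums equal the sums over `ℤ`. -/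
theorem IsGridSolution.gridFourier_eq {n : ℕ} (hn : 0 < n) {b : ℝ → ℂ} {f : ℝ → ℝ → ℂ}
    (hf : IsGridSolution n b f) {c d : ℤ} (hb : SupportedIn (fun j => b ((j : ℝ) / n)) c d)
    {t : ℝ} (ht0 : 0 ≤ t) (ht : t < n) (hc : -(n : ℤ) ^ 2 ≤ c - 2 * ⌊(n : ℝ) * t⌋₊)
    (hd : d < (n : ℤ) ^ 2) (y : ℝ) :
    gridFourier n (f t) y = gridSymbol n t y * gridFourier n b y := by
  have hn' : (0 : ℝ) < n := by positivity
  have h1 : ∀ j ∈ Finset.Ico (-(n : ℤ) ^ 2) ((n : ℤ) ^ 2), f t ((j : ℝ) / n) =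
      gridSol n (fun j => b ((j : ℝ) / n)) ⌊(n : ℝ) * t⌋₊ j := by
    intro j hj
    rw [Finset.mem_Ico] at hj
    have hj1 : (-(n : ℝ) ^ 2) ≤ j := by exact_mod_cast hj.1
    have hj2 : (j : ℝ) < (n : ℝ) ^ 2 := by exact_mod_cast hj.2
    rw [hf.apply hn ht0 ht (by rw [le_div_iff₀ hn']; linarith)
      (by rw [div_lt_iff₀ hn']; linarith), floor_mul_div hn]
  rw [NSHeat.gridFourier_eq hn, NSHeat.gridFourier_eq hn,
    Finset.sum_congr rfl fun j hj => by rw [h1 j hj],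
    ← tsum_mul_gridChar ((hb.gridSol _).mono hc hd.le) n (cell n y),
    ← tsum_mul_gridChar (hb.mono (by omega) hd.le) n (cell n y),
    tsum_gridSol hn hb hd, gridSymbol]
  ring

/-! ## The truncated inverse transform -/

theorem gridData_div {n : ℕ} (hn : 0 < n) (g : ℝ → ℂ) (w : ℕ) (j : ℤ) :
    gridData g n w ((j : ℝ) / n) =
      if -((w : ℤ) * n) ≤ j ∧ j < (w : ℤ) * n then g ((j : ℝ) / n) else 0 := by
  have hn' : (0 : ℝ) < n := by positivity
  rw [gridData, cell_intCast_div hn]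
  refine if_congr ?_ rfl rfl
  rw [le_div_iff₀ hn', div_lt_iff₀ hn', ← @Int.cast_le ℝ, ← @Int.cast_lt ℝ]
  push_cast
  rw [neg_mul]

theorem gridData_cell {n : ℕ} (hn : 0 < n) (g : ℝ → ℂ) (w : ℕ) (x : ℝ) :
    gridData g n w x = gridData g n w (cell n x) := by
  have hn' : (0 : ℝ) < n := by positivity
  rw [cell, gridData_div hn, gridData, cell]
  refine if_congr ?_ rfl rfl
  rw [Int.le_floor, Int.floor_lt]
  push_cast
  constructor
  · rintro ⟨h1, h2⟩
    constructor <;> nlinarith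
  · rintro ⟨h1, h2⟩
    constructor <;> nlinarith

theorem supportedIn_gridData {n : ℕ} (hn : 0 < n) (g : ℝ → ℂ) (w : ℕ) :
    SupportedIn (fun j => gridData g n w ((j : ℝ) / n)) (-((w : ℤ) * n)) ((w : ℤ) * n) :=
  fun j hj => by simp only [gridData_div hn, if_neg hj]

theorem gridFourier_gridData {n w : ℕ} (hn : 0 < n) (hw : w ≤ n) (g : ℝ → ℂ) (y : ℝ) :
    gridFourier n (gridData g n w) y = (1 / (n : ℂ)) *
      ∑ k ∈ Finset.Ico (-((w : ℤ) * n)) ((w : ℤ) * n), g ((k : ℝ) / n) * gridChar n (cell n y) k := by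
  have hwn : (w : ℤ) * n ≤ (n : ℤ) ^ 2 := by
    rw [sq]; gcongr
  have hs := supportedIn_gridData hn g w
  rw [gridFourier_eq hn, ← tsum_mul_gridChar (hs.mono (by omega) hwn), tsum_mul_gridChar hs]
  congr 1
  refine Finset.sum_congr rfl fun k hk => ?_
  rw [gridData_div hn, if_pos (Finset.mem_Ico.1 hk)]

/-- Interchange of the two finite sums; the product of the two characters depends only on the
difference of the positions. The condition `m < n` puts the extreme frequency index `m n` on the
grid. -/
theorem gridFourierInv_eq_sum_gridKernel {n w m : ℕ} (hn : 0 < n) (hw : w ≤ n) (hm : m < n)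
    (g : ℝ → ℂ) {u : ℝ → ℂ} {t : ℝ}
    (hu : ∀ y, u y = gridSymbol n t y * gridFourier n (gridData g n w) y) (x : ℝ) :
    gridFourierInv n (fun y => gridTrunc n m t y * u y) x =
      (1 / (n : ℂ)) * ∑ k ∈ Finset.Ico (-((w : ℤ) * n)) ((w : ℤ) * n),
        gridKernel n m t (cell n x - k / n) * g (k / n) := by
  have hmn : (m : ℤ) * n + 1 ≤ (n : ℤ) ^ 2 := by
    have h1 : (m : ℤ) + 1 ≤ n := by exact_mod_cast hm
    have h2 : (1 : ℤ) ≤ n := by exact_mod_cast hn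
    nlinarith
  have hsub : Finset.Ico (-((m : ℤ) * n)) ((m : ℤ) * n + 1) ⊆
      Finset.Ico (-(n : ℤ) ^ 2) ((n : ℤ) ^ 2) := Finset.Ico_subset_Ico (by omega) hmn
  rw [gridFourierInv, gridIntegral, ← Finset.sum_subset hsub]
  · simp only [gridKernel, Finset.mul_sum, Finset.sum_mul]
    rw [Finset.sum_comm]
    refine Finset.sum_congr rfl fun j hj => ?_
    have htr : gridTrunc n m t ((j : ℝ) / n) = 1 / 2 := by
      rw [Finset.mem_Ico] at hj
      rw [gridTrunc, floor_mul_div hn, if_pos ⟨hj.1, by omega⟩]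
    rw [htr, hu, gridFourier_gridData hn hw, cell_intCast_div hn]
    simp only [Finset.mul_sum, Finset.sum_mul]
    refine Finset.sum_congr rfl fun k _ => ?_
    have he : Complex.exp ((Real.pi * ((j : ℝ) / n) * (cell n x - k / n) : ℝ) * Complex.I) =
        gridChar n ((j : ℝ) / n) k * gridExp n ((j : ℝ) / n) x := by
      rw [gridChar, gridExp, ← Complex.exp_add, cell_intCast_div hn]
      congr 1
      push_cast
      ring
    rw [he]
    ring
  · intro j _ hj
    rw [gridTrunc, floor_mul_div hn, if_neg, zero_mul, zero_mul]
    rw [Finset.mem_Ico] at hj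
    omega

/-! ## Transfer -/

section

variable {ι : Type*} {φ : Ultrafilter ι}

/-- The universal-quantifier case of Łoś's theorem: a counterexample is chosen in each coordinate
where there is one. -/
theorem eventually_forall_of_forall_eventually {α : Type*} [Nonempty α] {l : Filter ι}
    {P : ι → α → Prop} (h : ∀ x : ι → α, ∀ᶠ i in l, P i (x i)) : ∀ᶠ i in l, ∀ x, P i x := by
  filter_upwards [h fun i => Classical.epsilon fun x => ¬ P i x] with i hi x
  by_contra hx
  exact Classical.epsilon_spec (p := fun x => ¬ P i x) ⟨x, hx⟩ hi

theorem isHeatSolution_coe {n : ι → ℕ} {b : ι → ℝ → ℂ} {f : ι → ℝ → ℝ → ℂ} :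
    IsHeatSolution (n : Star φ ℕ) (b : Star φ (ℝ → ℂ)) (f : Star φ (ℝ → ℝ → ℂ)) ↔
      ∀ᶠ i in φ, IsGridSolution (n i) (b i) (f i) := by
  constructor
  · intro h
    have h1 : ∀ᶠ i in φ, CellMeasurable (n i) (f i) := h.measurable
    have h2 : ∀ᶠ i in (φ : Filter ι), ∀ p : ℝ × ℝ, 0 ≤ p.1 → p.1 < ((n i : ℝ) ^ 2 - 1) / n i →
        -(n i : ℝ) ≤ p.2 ∧ p.2 < n i →
        discreteDt (n i) (f i) p.1 p.2 - discreteDx (n i) (discreteDx (n i) (f i)) p.1 p.2 = 0 := by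
      refine eventually_forall_of_forall_eventually fun p => ?_
      rw [Ultrafilter.eventually_imp, Ultrafilter.eventually_imp, Ultrafilter.eventually_imp]
      intro ht0 ht hx
      exact Germ.coe_eq.1 (h.heat (Germ.ofFun fun i => (p i).1) (Germ.ofFun fun i => (p i).2)
        (Germ.coe_le.2 ht0) (Germ.coe_lt.2 ht)
        ⟨Germ.coe_le.2 (hx.mono fun _ h => h.1), Germ.coe_lt.2 (hx.mono fun _ h => h.2)⟩)
    have h3 : ∀ᶠ i in (φ : Filter ι), ∀ x : ℝ, -(n i : ℝ) ≤ x ∧ x < n i → f i 0 x = b i x := by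
      refine eventually_forall_of_forall_eventually fun x => ?_
      rw [Ultrafilter.eventually_imp]
      intro hx
      exact Germ.coe_eq.1 (h.initial (Germ.ofFun x)
        ⟨Germ.coe_le.2 (hx.mono fun _ h => h.1), Germ.coe_lt.2 (hx.mono fun _ h => h.2)⟩)
    filter_upwards [h1, h2, h3] with i h1 h2 h3
    exact ⟨h1, fun t x ht0 ht hx1 hx2 => h2 (t, x) ht0 ht ⟨hx1, hx2⟩,
      fun x hx1 hx2 => h3 x ⟨hx1, hx2⟩⟩
  · intro h
    refine ⟨h.mono fun i hi => hi.measurable, fun t x => ?_, fun x => ?_⟩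
    · refine Germ.inductionOn₂ t x fun t x ht0 ht hx => Germ.coe_eq.2 ?_
      filter_upwards [h, Germ.coe_le.1 ht0, Germ.coe_lt.1 ht, Germ.coe_le.1 hx.1,
        Germ.coe_lt.1 hx.2] with i hi h1 h2 h3 h4
      exact hi.heat _ _ h1 h2 h3 h4
    · refine Germ.inductionOn x fun x hx => Germ.coe_eq.2 ?_
      filter_upwards [h, Germ.coe_le.1 hx.1, Germ.coe_lt.1 hx.2] with i hi h3 h4
      exact hi.initial _ h3 h4

/-- Each of the finitely many values below `N` is avoided on a set of the ultrafilter. -/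
theorem IsInfiniteNat.tendsto {n : ι → ℕ} (h : IsInfiniteNat (n : Star φ ℕ)) :
    Tendsto n φ atTop := by
  rw [tendsto_atTop]
  intro N
  have h' : ∀ᶠ i in φ, ∀ k ∈ Finset.range N, n i ≠ k := by
    rw [eventually_all_finset]
    intro k _
    rw [Ultrafilter.eventually_not]
    exact fun hk => h k (Germ.coe_eq.2 hk)
  filter_upwards [h'] with i hi
  by_contra hlt
  exact hi (n i) (Finset.mem_range.2 (not_le.1 hlt)) rfl

theorem hasStandardPart_coe {E : Type*} [NormedAddCommGroup E] {z : ι → E} {w : E} :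
    HasStandardPart (z : Star φ E) w ↔ Tendsto z φ (nhds w) := by
  rw [Metric.tendsto_nhds]
  refine forall₂_congr fun ε _ => ?_
  simp only [dist_eq_norm]
  exact Germ.coe_lt

end

end NSHeat

end

/-! ### The main theorem -/

theorem mainTheorem1 {ι : Type*} (φ : Ultrafilter ι)
    (g : ℝ → ℂ) (hg : Continuous g)
    (A B ρ : ℝ) (hρ : ρ < 2)
    (hgrowth : ∀ x : ℝ, ‖g x‖ ≤ A * Real.exp (B * |x| ^ ρ))
    (η ω ω' : NSHeat.Star φ ℕ)
    (hη : NSHeat.IsInfiniteNat η) (hω : NSHeat.IsInfiniteNat ω)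
    (hω' : NSHeat.IsInfiniteNat ω')
    (hηω : ∀ r : ℝ,
      (↑r : NSHeat.Star φ ℝ) < NSHeat.toHyperreal η - NSHeat.toHyperreal ω)
    (hωω' : NSHeat.toHyperreal ω < Filter.Germ.map (fun m : ℕ => Real.sqrt (m : ℝ)) ω')
    (hω'η : NSHeat.toHyperreal ω' <
      Filter.Germ.map (fun n : ℕ => Real.sqrt (Real.log (n : ℝ))) η) :
    (∃ f : NSHeat.Star φ (ℝ → ℝ → ℂ),
      NSHeat.IsHeatSolution η (NSHeat.starData g η ω) f) ∧
    ∀ f : NSHeat.Star φ (ℝ → ℝ → ℂ),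
      NSHeat.IsHeatSolution η (NSHeat.starData g η ω) f →
      -- `f` is the only solution on its domain
      (∀ f' : NSHeat.Star φ (ℝ → ℝ → ℂ),
        NSHeat.IsHeatSolution η (NSHeat.starData g η ω) f' →
        ∀ t x : NSHeat.Star φ ℝ, NSHeat.InTime η t → NSHeat.InSpace η x →
          NSHeat.eval₂ f' t x = NSHeat.eval₂ f t x) ∧
      -- its Fourier transform at finite times
      (∀ t x : NSHeat.Star φ ℝ, 0 ≤ t → (∃ r : ℝ, t ≤ (↑r : NSHeat.Star φ ℝ)) →
        NSHeat.InSpace η x →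
          NSHeat.eval₂ (NSHeat.starFourier η f) t x =
            NSHeat.eval₂ (NSHeat.starSymbol η) t x *
              NSHeat.eval₁ (NSHeat.starFourier₁ η (NSHeat.starData g η ω)) x) ∧
      -- the standard part of the inverse transform of the truncated Fourier transform
      (∀ (t x : NSHeat.Star φ ℝ) (t₀ x₀ : ℝ), 0 < t₀ →
        NSHeat.HasStandardPart t t₀ → NSHeat.HasStandardPart x x₀ →
          MeasureTheory.Integrable (NSHeat.heatIntegrand g t₀ x₀) ∧
          NSHeat.HasStandardPart
            (NSHeat.eval₂ (NSHeat.starFourierInv η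
              (NSHeat.starTrunc η ω' * NSHeat.starFourier η f)) t x)
            (NSHeat.classicalSolution g t₀ x₀)) := by
  induction η using Filter.Germ.inductionOn with | _ n
  induction ω using Filter.Germ.inductionOn with | _ w
  induction ω' using Filter.Germ.inductionOn with | _ m
  have hn := hη.tendsto
  have hw := hω.tendsto
  have hm := hω'.tendsto
  have hwm : ∀ᶠ i in φ, (w i : ℝ) < Real.sqrt (m i) := Filter.Germ.coe_lt.1 hωω'
  have hmn : ∀ᶠ i in φ, (m i : ℝ) < Real.sqrt (Real.log (n i)) := Filter.Germ.coe_lt.1 hω'η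
  have hnw : ∀ r : ℝ, ∀ᶠ i in φ, r < (n i : ℝ) - w i := fun r => Filter.Germ.coe_lt.1 (hηω r)
  have hfourier : ∀ f : ι → ℝ → ℝ → ℂ,
      (∀ᶠ i in φ, NSHeat.IsGridSolution (n i) (NSHeat.gridData g (n i) (w i)) (f i)) →
      ∀ (t : ι → ℝ) (r : ℝ), (∀ᶠ i in φ, 0 ≤ t i) → (∀ᶠ i in φ, t i ≤ r) →
      ∀ᶠ i in φ, ∀ y, NSHeat.gridFourier (n i) (f i (t i)) y =
        NSHeat.gridSymbol (n i) (t i) y *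
          NSHeat.gridFourier (n i) (NSHeat.gridData g (n i) (w i)) y := by
    intro f hf t r ht0 htr
    -- Up to time `r` the support moves left by at most `2 r n` cells; `n - w > 2 r` leaves `(n - w)
    -- n` of them free.
    filter_upwards [hf, ht0, htr, hnw (2 * r), hn.eventually_gt_atTop 0] with i hf ht0 htr hr hn0 y
    have hw0 : (0 : ℝ) ≤ w i := Nat.cast_nonneg _
    have hn1 : (0 : ℝ) < n i := by exact_mod_cast hn0
    refine hf.gridFourier_eq hn0 (NSHeat.supportedIn_gridData hn0 g (w i)) ht0 (by linarith) ?_ ?_ y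
    · have hfl : (⌊(n i : ℝ) * t i⌋₊ : ℝ) ≤ n i * t i := Nat.floor_le (by positivity)
      rw [← @Int.cast_le ℝ]
      push_cast
      nlinarith
    · rw [← @Int.cast_lt ℝ]
      push_cast
      nlinarith
  refine ⟨⟨Filter.Germ.ofFun fun i t x => NSHeat.gridSol (n i)
      (fun j => NSHeat.gridData g (n i) (w i) ((j : ℝ) / n i))
      ⌊(n i : ℝ) * t⌋.toNat ⌊(n i : ℝ) * x⌋, NSHeat.isHeatSolution_coe.2 ?_⟩, fun f hf => ?_⟩
  · filter_upwards [hn.eventually_gt_atTop 0] with i hi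
    exact NSHeat.exists_isGridSolution hi fun x _ _ => NSHeat.gridData_cell hi g _ x
  induction f using Filter.Germ.inductionOn with | _ f
  replace hf := NSHeat.isHeatSolution_coe.1 hf
  refine ⟨fun f' hf' t x => ?_, fun t x => ?_, fun t x t₀ x₀ ht₀ => ?_⟩
  · induction f' using Filter.Germ.inductionOn with | _ f'
    replace hf' := NSHeat.isHeatSolution_coe.1 hf'
    refine Filter.Germ.inductionOn₂ t x fun t x ht hx => Filter.Germ.coe_eq.2 ?_
    filter_upwards [hf, hf', hn.eventually_gt_atTop 0, Filter.Germ.coe_le.1 ht.1,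
      Filter.Germ.coe_lt.1 ht.2, Filter.Germ.coe_le.1 hx.1, Filter.Germ.coe_lt.1 hx.2]
      with i hf hf' hi h1 h2 h3 h4
    exact (hf'.apply hi h1 h2 h3 h4).trans (hf.apply hi h1 h2 h3 h4).symm
  · refine Filter.Germ.inductionOn₂ t x fun t x ht0 ht hx => Filter.Germ.coe_eq.2 ?_
    obtain ⟨r, hr⟩ := ht
    filter_upwards [hfourier f hf t r (Filter.Germ.coe_le.1 ht0) (Filter.Germ.coe_le.1 hr)]
      with i hi
    exact hi (x i)
  · refine Filter.Germ.inductionOn₂ t x fun t x ht hx => ?_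
    rw [NSHeat.hasStandardPart_coe] at ht hx
    constructor
    · obtain ⟨C, hC, hgC⟩ := NSHeat.exists_norm_le_mul_exp_sq hg hρ hgrowth
        (show 0 < 1 / (64 * t₀) by positivity)
      exact NSHeat.integrable_heatIntegrand hg x₀ ht₀ hC hgC
    · refine NSHeat.hasStandardPart_coe.2 ((NSHeat.tendsto_sum_gridKernel hg hρ hgrowth ht₀ hn hw
        hm hwm hmn ht hx).congr' ?_)
      have ht0 := ht.eventually (le_mem_nhds ht₀)
      have ht1 := ht.eventually (ge_mem_nhds (show t₀ < t₀ + 1 by linarith))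
      filter_upwards [hfourier f hf t (t₀ + 1) ht0 ht1, hn.eventually_gt_atTop 0, hnw 0, hmn]
        with i hi hn0 hwn hmn
      have hn1 : (0 : ℝ) < n i := by exact_mod_cast hn0
      -- From `m² < log n ≤ n - 1`.
      have hmn' : m i < n i := by
        have h1 : (m i : ℝ) ^ 2 < n i := by
          rw [Real.lt_sqrt (by positivity)] at hmn
          linarith [Real.log_le_sub_one_of_pos hn1]
        have h2 : m i ^ 2 < n i := by exact_mod_cast h1
        exact (Nat.le_self_pow two_ne_zero _).trans_lt h2
      have hwn' : w i ≤ n i := by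
        have : (w i : ℝ) ≤ n i := by linarith
        exact_mod_cast this
      exact (NSHeat.gridFourierInv_eq_sum_gridKernel hn0 hwn' hmn' g hi (x i)).symm
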